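/- Let $M$ be an $n$-dimensional smooth Riemannian manifold (Hausdorff, second countable, without boundary, not necessarily complete or connected), let $1 \le k \le n$, and let $e = (e_1,\dots,e_{n-k}) : M \to \mathbb{R}^{n-k}$ be twice continuously differentiable. Put $K = \{\xi \in M : e_i(\xi) = 0,\ i = 1,\dots,n-k\}$. Assume that $K$ is compact and that $0$ is a regular value of $e$, i.e. the differential of $e$ is surjective at every point of $K$ (so that $K$ is a compact $k$-dimensional embedded $C^2$ submanifold of $M$, or empty). Let $k_1,\dots,k_{n-k} > 0$ be constants and let $\bot_e$ be any continuously differentiable vector field on $M$ with $\langle \bot_e(\xi), \operatorname{grad} e_i(\xi)\rangle = 0$ for all $\xi \in M$ and $i = 1,\dots,n-k$. Consider the guiding vector field $$\chi(\xi) = \bot_e(\xi) - \sum_{i=1}^{n-k} k_i\, e_i(\xi)\, \operatorname{grad} e_i(\xi), \qquad \xi \in M,$$ and the differential equation $\dot\xi(t) = \chi(\xi(t))$. **Theorem.** If $K$ is asymptotically stable for $\dot\xi = \chi(\xi)$ (that is, for every $\varepsilon>0$ there is $\delta>0$ such that every trajectory starting at distance less than $\delta$ from $K$ exists for all $t \ge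 0$ and stays at distance less than $\varepsilon$ from $K$, and moreover all trajectories starting sufficiently near $K$ converge to $K$), then the domain of attraction of $K$, i.e. the set of those $x \in M$ for which the trajectory with $\xi(0) = x$ exists for all $t \ge 0$ and satisfies $\operatorname{dist}(\xi(t), K) \to 0$ as $t \to \infty$, with the subspace topology from $M$, is homeomorphic to $\mathbb{R}^{n-k} \times K$. -/

import Mathlib

open Set Filter Topology Manifold Bundle
open scoped ContDiff ENNReal

noncomputable section

namespace GuidingField

section Gradient

variable {n : ℕ} {M : Type*} [TopologicalSpace M] [ChartedSpace (EuclideanSpace ℝ (Fin n)) M]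
  [RiemannianBundle (fun x : M => TangentSpace (𝓡 n) x)]

/-- Each tangent space is complete for the norm given by the Riemannian metric,
being finite-dimensional. -/
theorem completeSpace_tangentSpace (x : M) : CompleteSpace (TangentSpace (𝓡 n) x) :=
  haveI : FiniteDimensional ℝ (TangentSpace (𝓡 n) x) :=
    inferInstanceAs (FiniteDimensional ℝ (EuclideanSpace ℝ (Fin n)))
  FiniteDimensional.complete ℝ (TangentSpace (𝓡 n) x)

/-- The Riemannian gradient of `f : M → ℝ` at `x`: the tangent vector which represents the
differential of `f` at `x` with respect to the Riemannian metric. -/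
def grad (f : M → ℝ) (x : M) : TangentSpace (𝓡 n) x :=
  haveI : CompleteSpace (TangentSpace (𝓡 n) x) := completeSpace_tangentSpace x
  (InnerProductSpace.toDual ℝ (TangentSpace (𝓡 n) x)).symm (mfderiv (𝓡 n) 𝓘(ℝ, ℝ) f x)

/-- The defining property of the gradient. -/
theorem inner_grad (f : M → ℝ) (x : M) (v : TangentSpace (𝓡 n) x) :
    inner ℝ (grad f x) v = (mfderiv (𝓡 n) 𝓘(ℝ, ℝ) f x : TangentSpace (𝓡 n) x →L[ℝ] ℝ) v := by
  have : CompleteSpace (TangentSpace (𝓡 n) x) := completeSpace_tangentSpace x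
  exact InnerProductSpace.toDual_symm_apply

/-- The guiding vector field `χ = ⊥ₑ - ∑ i, κ i • e i • grad (e i)` with error map
`e = (e 0, …, e (m - 1))`, gains `κ` and propagation term `perp`. -/
def guidingField {m : ℕ} (e : M → EuclideanSpace ℝ (Fin m)) (κ : Fin m → ℝ)
    (perp : ∀ x : M, TangentSpace (𝓡 n) x) (x : M) : TangentSpace (𝓡 n) x :=
  perp x - ∑ i : Fin m, (κ i * e x i) • grad (fun y => e y i) x

end Gradient

section Zero

variable {M : Type*} {m : ℕ}

/-- The zero-level set of `e`. -/
def zeroLevel (e : M → EuclideanSpace ℝ (Fin m)) : Set M := {x | e x = 0}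

/-- `0` is a regular value of `e`: the differential of `e` is surjective at every point of the
zero-level set. -/
def IsRegularZeroLevel (n : ℕ) [TopologicalSpace M] [ChartedSpace (EuclideanSpace ℝ (Fin n)) M]
    (e : M → EuclideanSpace ℝ (Fin m)) : Prop :=
  ∀ x ∈ zeroLevel e,
    Function.Surjective (mfderiv (𝓡 n) 𝓘(ℝ, EuclideanSpace ℝ (Fin m)) e x)

end Zero

section Dynamics

variable {n : ℕ} {M : Type*} [EMetricSpace M] [ChartedSpace (EuclideanSpace ℝ (Fin n)) M]

/-- `γ` restricted to `[0, ∞)` is a solution of `γ' = v(γ)` with `γ 0 = x`. -/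
def IsForwardTrajectory (v : ∀ x : M, TangentSpace (𝓡 n) x) (x : M) (γ : ℝ → M) : Prop :=
  γ 0 = x ∧ IsMIntegralCurveOn (I := 𝓡 n) γ v (Ici 0)

/-- The domain of attraction of `A`: the initial conditions whose trajectory exists for all
`t ≥ 0` and whose distance to `A` tends to `0`. -/
def domainOfAttraction (v : ∀ x : M, TangentSpace (𝓡 n) x) (A : Set M) : Set M :=
  {x | ∃ γ : ℝ → M, IsForwardTrajectory v x γ ∧
    Tendsto (fun t => Metric.infEDist (γ t) A) atTop (𝓝 0)}

/-- `A` is (Lyapunov) stable and locally attractive. -/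
def IsAsymptoticallyStable (v : ∀ x : M, TangentSpace (𝓡 n) x) (A : Set M) : Prop :=
  (∀ ε : ℝ≥0∞, 0 < ε → ∃ δ : ℝ≥0∞, 0 < δ ∧ ∀ x : M, Metric.infEDist x A < δ →
    (∃ γ : ℝ → M, IsForwardTrajectory v x γ) ∧
      ∀ γ : ℝ → M, IsForwardTrajectory v x γ → ∀ t : ℝ, 0 ≤ t → Metric.infEDist (γ t) A < ε) ∧
  ∃ r : ℝ≥0∞, 0 < r ∧ ∀ x : M, Metric.infEDist x A < r → x ∈ domainOfAttraction v A

end Dynamics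

end GuidingField

end

/-! Replacing e_i by √k_i e_i reduces to unit gains. The propagation term is orthogonal to every
grad e_i, so along trajectories d/dt ‖e‖² = -2 ‖Σ e_i grad e_i‖². Hence ‖e‖ never increases
(`norm_flow_le`), and it drops strictly from any point where e ≠ 0 and the gradients are independent
(`norm_flow_lt`).

Near K, regularity provides fields X_v, combinations of the gradients, with de(X_v) = v. Following
X_v from K for unit time identifies K × (closed ball of radius c) with a compact neighbourhood N of
K on which e is the ball coordinate (`exists_tube`). Taken inside the domain of attraction, N is
trapping: its points move at once into {‖e‖ < c} and stay there (`isTrapping_guiding`). The domain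
of attraction is then the set of points that reach N (`domainOfAttraction_eq_basin`).

Such a point is determined by the time τ and the place σ at which it first meets N, where ‖e(σ)‖ = c
unless τ = 0; both depend continuously on the point. So the basin is N with a backward trajectory
glued to each point of its boundary {‖e‖ = c}. As M need not be complete, that trajectory may exist
for a finite time only, depending on the boundary point. `fiberScale` stretches its time interval to
[0, ∞), continuously in the point, by means of the reciprocal distance to the set where the backward
flow is undefined. A closed ball with a half-line attached at each boundary point is ℝ^(n-k) in
radial coordinates, which gives the homeomorphism (`nonempty_homeomorph_basin`). Only continuity of
the flow is needed there. -/

noncomputable section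

/-! ### Local flow of a C^1 vector field -/

section Flow

variable {E : Type*} [NormedAddCommGroup E] [NormedSpace ℝ E]
  {H : Type*} [TopologicalSpace H] {I : ModelWithCorners ℝ E H}
  {M : Type*} [TopologicalSpace M] [ChartedSpace H M]

/-- A curve which solves, in a chart, the ODE of the coordinate expression of `v` is an integral
curve of `v`. -/
theorem hasMFDerivAt_extChartAt_symm_comp [IsManifold I 1 M] {v : (x : M) → TangentSpace I x}
    {x₀ : M} {f : ℝ → E} {t : ℝ}
    (h : HasDerivAt f (tangentCoordChange I ((extChartAt I x₀).symm (f t)) x₀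
      ((extChartAt I x₀).symm (f t)) (v ((extChartAt I x₀).symm (f t)))) t)
    (hf3 : f t ∈ interior (extChartAt I x₀).target) :
    HasMFDerivAt 𝓘(ℝ, ℝ) I ((extChartAt I x₀).symm ∘ f) t
      ((1 : ℝ →L[ℝ] ℝ).smulRight (v ((extChartAt I x₀).symm (f t)))) := by
  let xₜ : M := (extChartAt I x₀).symm (f t)
  have hf3' := mem_of_mem_of_subset hf3 interior_subset
  have hft1 := mem_preimage.mp <|
    mem_of_mem_of_subset hf3' (extChartAt I x₀).target_subset_preimage_source
  have hft2 := mem_extChartAt_source (I := I) xₜ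
  have hcoord : tangentCoordChange I x₀ xₜ xₜ (tangentCoordChange I xₜ x₀ xₜ (v xₜ)) = v xₜ :=
    (tangentCoordChange_comp ⟨⟨hft2, hft1⟩, hft2⟩).trans (tangentCoordChange_self hft2)
  have hchange : HasFDerivAt (extChartAt I xₜ ∘ (extChartAt I x₀).symm)
      (tangentCoordChange I x₀ xₜ xₜ) (f t) := by
    apply HasFDerivWithinAt.hasFDerivAt (s := range I) _ <|
      mem_nhds_iff.mpr ⟨interior (extChartAt I x₀).target,
        subset_trans interior_subset (extChartAt_target_subset_range ..),
        isOpen_interior, hf3⟩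
    rw [← (extChartAt I x₀).right_inv hf3']
    exact hasFDerivWithinAt_tangentCoordChange ⟨hft1, hft2⟩
  have hderiv := hchange.comp_hasDerivAt t h
  refine ⟨(continuousAt_extChartAt_symm'' hf3').comp h.continuousAt, ?_⟩
  have hfderiv : HasFDerivAt ((extChartAt I xₜ ∘ (extChartAt I x₀).symm) ∘ f)
      ((1 : ℝ →L[ℝ] ℝ).smulRight (v xₜ : E)) t :=
    (hderiv.congr_deriv hcoord).hasFDerivAt
  exact hfderiv.hasFDerivWithinAt

/-- A `C^1` vector field has a continuous local flow around each point. -/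
theorem exists_continuousOn_local_flow [CompleteSpace E] [IsManifold I 1 M]
    [BoundarylessManifold I M] {v : (x : M) → TangentSpace I x}
    (hv : ContMDiff I I.tangent 1 (fun x => (⟨x, v x⟩ : TangentBundle I M))) (x₀ : M) :
    ∃ U ∈ 𝓝 x₀, ∃ ε > 0, ∃ Φ : ℝ × M → M,
      (∀ x ∈ U, Φ (0, x) = x ∧ IsMIntegralCurveOn (fun t => Φ (t, x)) v (Ioo (-ε) ε)) ∧
      ContinuousOn Φ (Ioo (-ε) ε ×ˢ U) := by
  have hx : I.IsInteriorPoint x₀ := BoundarylessManifold.isInteriorPoint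
  have hv := hv.contMDiffAt (x := x₀)
  rw [contMDiffAt_iff] at hv
  obtain ⟨_, hv⟩ := hv
  obtain ⟨ε, hε, a, r, L, C, hr, hpl⟩ := IsPicardLindelof.of_contDiffAt_one
    (hv.contDiffAt (range_mem_nhds_isInteriorPoint hx)).snd
  obtain ⟨α, hα, hcont⟩ := (hpl 0).exists_forall_mem_closedBall_eq_hasDerivWithinAt_continuousOn
  set y₀ := extChartAt I x₀ x₀ with hy₀
  have hnhds : Metric.closedBall y₀ r ×ˢ Icc (0 - ε) (0 + ε) ∈ 𝓝 (y₀, (0 : ℝ)) :=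
    prod_mem_nhds (Metric.closedBall_mem_nhds _ hr) (Icc_mem_nhds (by linarith) (by linarith))
  have hca : ContinuousAt α (y₀, 0) := hcont.continuousAt hnhds
  have hα0 : α (y₀, 0) = y₀ := (hα y₀ (Metric.mem_closedBall_self r.2)).1
  have hpre : α ⁻¹' interior (extChartAt I x₀).target ∈ 𝓝 (y₀, (0 : ℝ)) := by
    apply hca
    rw [hα0]
    exact isOpen_interior.mem_nhds ((I.isInteriorPoint_iff).mp hx)
  -- Shrinking in time and space keeps coordinate solutions in the interior of the chart target,
  -- where they transfer to M.
  obtain ⟨W, hW, T, hT, hWT⟩ := mem_nhds_prod_iff.mp (inter_mem hnhds hpre)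
  obtain ⟨ε', hε', hTε⟩ := Metric.mem_nhds_iff.mp hT
  rw [Real.ball_eq_Ioo, zero_sub, zero_add] at hTε
  refine ⟨(extChartAt I x₀).source ∩ extChartAt I x₀ ⁻¹' W,
    inter_mem (extChartAt_source_mem_nhds x₀) ((continuousAt_extChartAt x₀) hW), ε', hε',
    fun p => (extChartAt I x₀).symm (α (extChartAt I x₀ p.2, p.1)), fun x hx => ⟨?_, ?_⟩, ?_⟩
  · have := (hWT (mk_mem_prod hx.2 (mem_of_mem_nhds hT))).1
    simp only
    rw [(hα _ this.1).1, (extChartAt I x₀).left_inv hx.1]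
  · intro t ht
    have h1 := hWT (mk_mem_prod hx.2 (hTε ht))
    have h2 : ∀ᶠ s in 𝓝 t, s ∈ Icc (0 - ε) (0 + ε) := by
      filter_upwards [Ioo_mem_nhds ht.1 ht.2] with s hs
      exact (hWT (mk_mem_prod hx.2 (hTε hs))).1.2
    have h3 := ((hα _ h1.1.1).2 t h1.1.2).hasDerivAt h2
    exact (hasMFDerivAt_extChartAt_symm_comp (f := fun t => α (extChartAt I x₀ x, t))
      h3 h1.2).hasMFDerivWithinAt
  · have h1 : ContinuousOn (fun p : ℝ × M => (extChartAt I x₀ p.2, p.1))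
        (Ioo (-ε') ε' ×ˢ ((extChartAt I x₀).source ∩ extChartAt I x₀ ⁻¹' W)) := by
      refine ContinuousOn.prodMk ?_ continuousOn_fst
      exact (continuousOn_extChartAt x₀).comp continuousOn_snd fun p hp => hp.2.1
    have h2 : MapsTo (fun p : ℝ × M => (extChartAt I x₀ p.2, p.1))
        (Ioo (-ε') ε' ×ˢ ((extChartAt I x₀).source ∩ extChartAt I x₀ ⁻¹' W)) (W ×ˢ T) :=
      fun p hp => mk_mem_prod hp.2.2 (hTε hp.1)
    refine (continuousOn_extChartAt_symm x₀).comp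
      ((hcont.mono fun p hp => (hWT hp).1).comp h1 h2) fun p hp => ?_
    exact interior_subset (hWT (h2 hp)).2

end Flow

/-! ### Maximal flow: group law, open domain, continuity -/

section Flow

variable {E : Type*} [NormedAddCommGroup E] [NormedSpace ℝ E]
  {H : Type*} [TopologicalSpace H] {I : ModelWithCorners ℝ E H}
  {M : Type*} [TopologicalSpace M] [ChartedSpace H M]

/-- The domain of the maximal flow of `v`: pairs `(t, x)` such that the integral curve through `x`
is defined on an open interval containing `0` and `t`. -/
def flowDomain (v : (x : M) → TangentSpace I x) : Set (ℝ × M) :=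
  {p | ∃ (γ : ℝ → M) (a b : ℝ), (0 : ℝ) ∈ Ioo a b ∧ p.1 ∈ Ioo a b ∧ γ 0 = p.2 ∧
    IsMIntegralCurveOn γ v (Ioo a b)}

open Classical in
/-- The maximal flow of `v`, with junk value `x` at `(t, x)` outside its domain. -/
def flow (v : (x : M) → TangentSpace I x) (p : ℝ × M) : M :=
  if h : p ∈ flowDomain v then h.choose p.1 else p.2

theorem mem_flowDomain {v : (x : M) → TangentSpace I x} {γ : ℝ → M} {a b t : ℝ} {x : M}
    (h0 : (0 : ℝ) ∈ Ioo a b) (ht : t ∈ Ioo a b) (hγ0 : γ 0 = x)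
    (hγ : IsMIntegralCurveOn γ v (Ioo a b)) : (t, x) ∈ flowDomain v :=
  ⟨γ, a, b, h0, ht, hγ0, hγ⟩

theorem flowDomain_uIcc {v : (x : M) → TangentSpace I x} {s t : ℝ} {x : M}
    (h : (t, x) ∈ flowDomain v) (hs : s ∈ uIcc 0 t) : (s, x) ∈ flowDomain v := by
  obtain ⟨γ, a, b, h0, ht, hγ0, hγ⟩ := h
  exact ⟨γ, a, b, h0, ordConnected_Ioo.uIcc_subset h0 ht hs, hγ0, hγ⟩

variable [IsManifold I 1 M] [BoundarylessManifold I M] [T2Space M]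
  {v : (x : M) → TangentSpace I x}

/-- By uniqueness on the common interval, the curve chosen in `flow` does not matter. -/
theorem flow_eq (hv : ContMDiff I I.tangent 1 (fun x => (⟨x, v x⟩ : TangentBundle I M)))
    {γ : ℝ → M} {a b t : ℝ} {x : M}
    (h0 : (0 : ℝ) ∈ Ioo a b) (ht : t ∈ Ioo a b) (hγ0 : γ 0 = x)
    (hγ : IsMIntegralCurveOn γ v (Ioo a b)) : flow v (t, x) = γ t := by
  have h : (t, x) ∈ flowDomain v := mem_flowDomain h0 ht hγ0 hγ
  rw [flow, dif_pos h]
  obtain ⟨a', b', h0', ht', hγ0', hγ'⟩ := h.choose_spec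
  exact isMIntegralCurveOn_Ioo_eqOn_of_contMDiff_boundaryless (t₀ := 0) (a := max a a')
    (b := min b b') ⟨max_lt h0.1 h0'.1, lt_min h0.2 h0'.2⟩ hv
    (hγ'.mono (Ioo_subset_Ioo (le_max_right _ _) (min_le_right _ _)))
    (hγ.mono (Ioo_subset_Ioo (le_max_left _ _) (min_le_left _ _)))
    (hγ0'.trans hγ0.symm) ⟨max_lt ht.1 ht'.1, lt_min ht.2 ht'.2⟩

/-- Two curves through x glue along the overlap of their intervals, which contains 0. One curve then
serves both times. -/
theorem exists_curve_of_mem_flowDomain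
    (hv : ContMDiff I I.tangent 1 (fun x => (⟨x, v x⟩ : TangentBundle I M)))
    {s t : ℝ} {x : M} (hs : (s, x) ∈ flowDomain v) (ht : (t, x) ∈ flowDomain v) :
    ∃ (γ : ℝ → M) (a b : ℝ), (0 : ℝ) ∈ Ioo a b ∧ s ∈ Ioo a b ∧ t ∈ Ioo a b ∧ γ 0 = x ∧
      IsMIntegralCurveOn γ v (Ioo a b) := by
  obtain ⟨γ, a, b, h0, hs, hγ0, hγ⟩ := hs
  obtain ⟨γ', a', b', h0', ht, hγ0', hγ'⟩ := ht
  have key := isMIntegralCurveOn_piecewise hv hγ hγ' (t₀ := 0) ⟨h0, h0'⟩ (hγ0.trans hγ0'.symm)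
  rw [Ioo_union_Ioo' (h0'.1.trans h0.2) (h0.1.trans h0'.2)] at key
  refine ⟨_, _, _, ⟨?_, ?_⟩, ⟨?_, ?_⟩, ⟨?_, ?_⟩, ?_, key⟩
  · exact min_lt_of_left_lt h0.1
  · exact lt_max_of_lt_left h0.2
  · exact min_lt_of_left_lt hs.1
  · exact lt_max_of_lt_left hs.2
  · exact min_lt_of_right_lt ht.1
  · exact lt_max_of_lt_right ht.2
  · rw [piecewise_eq_of_mem _ _ _ h0, hγ0]

theorem isMIntegralCurveAt_flow
    (hv : ContMDiff I I.tangent 1 (fun x => (⟨x, v x⟩ : TangentBundle I M)))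
    {t : ℝ} {x : M} (h : (t, x) ∈ flowDomain v) :
    IsMIntegralCurveAt (fun s => flow v (s, x)) v t := by
  obtain ⟨γ, a, b, h0, ht, hγ0, hγ⟩ := h
  rw [isMIntegralCurveAt_iff]
  refine ⟨Ioo a b, Ioo_mem_nhds ht.1 ht.2, fun s hs => ?_⟩
  have := flow_eq hv h0 hs hγ0 hγ
  change HasMFDerivWithinAt 𝓘(ℝ, ℝ) I (fun s => flow v (s, x)) (Ioo a b) s
    ((1 : ℝ →L[ℝ] ℝ).smulRight (v (flow v (s, x))))
  rw [this]
  exact HasMFDerivWithinAt.congr_mono (hγ s hs) (fun r hr => flow_eq hv h0 hr hγ0 hγ) this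
    Subset.rfl

/-- The derivative of a function along the flow. -/
theorem hasDerivAt_comp_flow
    (hv : ContMDiff I I.tangent 1 (fun x => (⟨x, v x⟩ : TangentBundle I M)))
    {F : Type*} [NormedAddCommGroup F] [NormedSpace ℝ F] {f : M → F} {t : ℝ} {x : M}
    (h : (t, x) ∈ flowDomain v) (hf : MDifferentiableAt I 𝓘(ℝ, F) f (flow v (t, x))) :
    HasDerivAt (fun s => f (flow v (s, x)))
      ((mfderiv I 𝓘(ℝ, F) f (flow v (t, x)) : TangentSpace I (flow v (t, x)) →L[ℝ] F)
        (v (flow v (t, x)))) t := by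
  let D : E →L[ℝ] F := mfderiv I 𝓘(ℝ, F) f (flow v (t, x))
  let w : E := v (flow v (t, x))
  have h1 : HasFDerivAt (fun s => f (flow v (s, x))) (D.comp ((1 : ℝ →L[ℝ] ℝ).smulRight w)) t :=
    hasMFDerivAt_iff_hasFDerivAt.mp (HasMFDerivAt.comp t hf.hasMFDerivAt (isMIntegralCurveAt_flow hv h).hasMFDerivAt)
  have h2 : HasDerivAt (fun s => f (flow v (s, x))) (D ((1 : ℝ) • w)) t := h1.hasDerivAt
  rw [one_smul] at h2
  exact h2

/-- Sufficient condition for membership in the flow domain after a time shift. -/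
theorem flow_of_shifted_curve
    (hv : ContMDiff I I.tangent 1 (fun x => (⟨x, v x⟩ : TangentBundle I M)))
    {γ : ℝ → M} {a b s t : ℝ} {x : M} (hs : s ∈ Ioo a b) (ht : s + t ∈ Ioo a b)
    (hγs : γ s = x) (hγ : IsMIntegralCurveOn γ v (Ioo a b)) :
    (t, x) ∈ flowDomain v ∧ flow v (t, x) = γ (s + t) := by
  have h := hγ.comp_add s
  have hset : {t : ℝ | t + s ∈ Ioo a b} = Ioo (a - s) (b - s) := by
    ext r
    simp only [mem_ofPred_eq, mem_Ioo]
    constructor <;> rintro ⟨h1, h2⟩ <;> constructor <;> linarith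
  rw [hset] at h
  have h0 : (0 : ℝ) ∈ Ioo (a - s) (b - s) := ⟨by linarith [hs.1], by linarith [hs.2]⟩
  have ht' : t ∈ Ioo (a - s) (b - s) := ⟨by linarith [ht.1], by linarith [ht.2]⟩
  have hx : (γ ∘ (· + s)) 0 = x := by simp [hγs]
  refine ⟨mem_flowDomain h0 ht' hx h, ?_⟩
  rw [flow_eq hv h0 ht' hx h, Function.comp_apply, add_comm]

/-- Both times lie on one curve, so this is a time shift. Assuming membership of s + t, rather than
of t at the later point, avoids concatenating curves; `flow_neg` and `flow_add` follow formally. -/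
theorem flow_sub
    (hv : ContMDiff I I.tangent 1 (fun x => (⟨x, v x⟩ : TangentBundle I M)))
    {s t : ℝ} {x : M} (hs : (s, x) ∈ flowDomain v) (ht : (s + t, x) ∈ flowDomain v) :
    (t, flow v (s, x)) ∈ flowDomain v ∧ flow v (t, flow v (s, x)) = flow v (s + t, x) := by
  obtain ⟨γ, a, b, h0, hs, ht, hγ0, hγ⟩ := exists_curve_of_mem_flowDomain hv hs ht
  rw [flow_eq hv h0 hs hγ0 hγ, flow_eq hv h0 ht hγ0 hγ]
  exact flow_of_shifted_curve hv hs ht rfl hγ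

variable [CompleteSpace E]

theorem exists_nhds_flow
    (hv : ContMDiff I I.tangent 1 (fun x => (⟨x, v x⟩ : TangentBundle I M))) (x₀ : M) :
    ∃ U ∈ 𝓝 x₀, ∃ ε > 0, Ioo (-ε) ε ×ˢ U ⊆ flowDomain v ∧
      ContinuousOn (flow v) (Ioo (-ε) ε ×ˢ U) := by
  obtain ⟨U, hU, ε, hε, Φ, hΦ, hc⟩ := exists_continuousOn_local_flow hv x₀
  have h0 : (0 : ℝ) ∈ Ioo (-ε) ε := ⟨by linarith, hε⟩
  refine ⟨U, hU, ε, hε, ?_, hc.congr ?_⟩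
  · rintro ⟨t, x⟩ ⟨ht, hx⟩
    exact mem_flowDomain h0 ht (hΦ x hx).1 (hΦ x hx).2
  · rintro ⟨t, x⟩ ⟨ht, hx⟩
    exact flow_eq hv h0 ht (hΦ x hx).1 (hΦ x hx).2

theorem flowDomain_zero
    (hv : ContMDiff I I.tangent 1 (fun x => (⟨x, v x⟩ : TangentBundle I M))) (x : M) :
    ((0 : ℝ), x) ∈ flowDomain v := by
  obtain ⟨U, hU, ε, hε, h, -⟩ := exists_nhds_flow hv x
  exact h ⟨⟨by simpa using hε, by simpa using hε⟩, mem_of_mem_nhds hU⟩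

theorem flow_zero
    (hv : ContMDiff I I.tangent 1 (fun x => (⟨x, v x⟩ : TangentBundle I M))) (x : M) :
    flow v (0, x) = x := by
  obtain ⟨γ, a, b, h0, hs, hγ0, hγ⟩ := flowDomain_zero hv x
  exact (flow_eq hv h0 h0 hγ0 hγ).trans hγ0

theorem flow_neg
    (hv : ContMDiff I I.tangent 1 (fun x => (⟨x, v x⟩ : TangentBundle I M)))
    {s : ℝ} {x : M} (hs : (s, x) ∈ flowDomain v) :
    (-s, flow v (s, x)) ∈ flowDomain v ∧ flow v (-s, flow v (s, x)) = x := by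
  have h : (s + -s, x) ∈ flowDomain v := by
    rw [add_neg_cancel]
    exact flowDomain_zero hv x
  refine ⟨(flow_sub hv hs h).1, ?_⟩
  rw [(flow_sub hv hs h).2, add_neg_cancel, flow_zero hv]

theorem flow_add
    (hv : ContMDiff I I.tangent 1 (fun x => (⟨x, v x⟩ : TangentBundle I M)))
    {s t : ℝ} {x : M} (hs : (s, x) ∈ flowDomain v) (ht : (t, flow v (s, x)) ∈ flowDomain v) :
    (s + t, x) ∈ flowDomain v ∧ flow v (s + t, x) = flow v (t, flow v (s, x)) := by
  obtain ⟨h1, h2⟩ := flow_neg hv hs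
  -- From the point reached at time s: go back by s, then forward by s + t.
  have h := flow_sub hv (s := -s) (t := s + t) (x := flow v (s, x)) h1
    (by rwa [neg_add_cancel_left])
  rwa [h2, neg_add_cancel_left] at h

/-- Near (t, x) the flow is the time-s map followed by a flow box around the point reached at time
s, so good behaviour at s passes to t. -/
theorem flow_continuousAt_step
    (hv : ContMDiff I I.tangent 1 (fun x => (⟨x, v x⟩ : TangentBundle I M)))
    {U : Set M} {ε : ℝ} (hsub : Ioo (-ε) ε ×ˢ U ⊆ flowDomain v)
    (hc : ContinuousOn (flow v) (Ioo (-ε) ε ×ˢ U)) {s t : ℝ} {x : M}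
    (hs : flowDomain v ∈ 𝓝 (s, x)) (hcs : ContinuousAt (flow v) (s, x))
    (hU : U ∈ 𝓝 (flow v (s, x))) (ht : t - s ∈ Ioo (-ε) ε) :
    flowDomain v ∈ 𝓝 (t, x) ∧ ContinuousAt (flow v) (t, x) := by
  have h1 : Tendsto (fun q : ℝ × M => (s, q.2)) (𝓝 (t, x)) (𝓝 (s, x)) :=
    Continuous.tendsto' (by fun_prop) _ _ rfl
  have h2 : ContinuousAt (fun q : ℝ × M => (q.1 - s, flow v (s, q.2))) (t, x) := by
    refine ContinuousAt.prodMk (by fun_prop) ?_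
    exact ContinuousAt.comp (g := flow v) (f := fun q : ℝ × M => (s, q.2)) hcs h1
  have hnb : Ioo (-ε) ε ×ˢ U ∈ 𝓝 (t - s, flow v (s, x)) :=
    prod_mem_nhds (Ioo_mem_nhds ht.1 ht.2) hU
  have h3 : ∀ᶠ q in 𝓝 (t, x), q ∈ flowDomain v ∧
      flow v q = flow v (q.1 - s, flow v (s, q.2)) := by
    filter_upwards [h1 hs, h2 hnb] with q hq1 hq2
    have := flow_add hv hq1 (hsub hq2)
    rwa [add_sub_cancel] at this
  refine ⟨h3.mono fun q hq => hq.1, ?_⟩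
  refine ContinuousAt.congr ?_ (h3.mono fun q hq => hq.2.symm)
  exact ContinuousAt.comp (g := flow v) (hc.continuousAt hnb) h2

/-- Connectedness of the time interval: the good times are open and contain 0. A limit s of good
times is good because a flow box around γ s has a uniform time span, so one step from a nearby good
time reaches s. -/
theorem flowDomain_mem_nhds_and_continuousAt
    (hv : ContMDiff I I.tangent 1 (fun x => (⟨x, v x⟩ : TangentBundle I M)))
    {t : ℝ} {x : M} (h : (t, x) ∈ flowDomain v) :
    flowDomain v ∈ 𝓝 (t, x) ∧ ContinuousAt (flow v) (t, x) := by
  obtain ⟨γ, a, b, h0, ht, hγ0, hγ⟩ := h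
  set u : Set ℝ := {t | flowDomain v ∈ 𝓝 (t, x) ∧ ContinuousAt (flow v) (t, x)} with hu
  suffices Ioo a b ⊆ u from this ht
  have hflow : ∀ s ∈ Ioo a b, flow v (s, x) = γ s := fun s hs => flow_eq hv h0 hs hγ0 hγ
  refine isPreconnected_Ioo.subset_of_closure_inter_subset ?_ ⟨0, h0, ?_⟩ ?_
  · rw [isOpen_iff_mem_nhds]
    intro s hs
    obtain ⟨U, hU, ε, hε, hsub, hc⟩ := exists_nhds_flow hv (flow v (s, x))
    filter_upwards [Ioo_mem_nhds (sub_lt_self s hε) (lt_add_of_pos_right s hε)] with r hr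
    exact flow_continuousAt_step hv hsub hc hs.1 hs.2 hU
      ⟨by linarith [hr.1], by linarith [hr.2]⟩
  · obtain ⟨U, hU, ε, hε, hsub, hc⟩ := exists_nhds_flow hv x
    have hnb : Ioo (-ε) ε ×ˢ U ∈ 𝓝 ((0 : ℝ), x) :=
      prod_mem_nhds (Ioo_mem_nhds (by linarith) hε) hU
    exact ⟨mem_of_superset hnb hsub, hc.continuousAt hnb⟩
  · rintro s ⟨hs, hsI⟩
    obtain ⟨U, hU, ε, hε, hsub, hc⟩ := exists_nhds_flow hv (γ s)
    have hγc : ContinuousAt γ s := (hγ.continuousWithinAt hsI).continuousAt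
      (Ioo_mem_nhds hsI.1 hsI.2)
    have hev : ∀ᶠ r in 𝓝 s, r ∈ Ioo a b ∧ U ∈ 𝓝 (γ r) ∧ r ∈ Ioo (s - ε) (s + ε) :=
      Eventually.and (Ioo_mem_nhds hsI.1 hsI.2)
        ((hγc.eventually (eventually_mem_nhds_iff.mpr hU)).and
          (Ioo_mem_nhds (sub_lt_self s hε) (lt_add_of_pos_right s hε)))
    obtain ⟨r, ⟨hr1, hr2, hr3⟩, hr⟩ := mem_closure_iff_nhds.mp hs _ hev
    refine flow_continuousAt_step hv hsub hc hr.1 hr.2 ?_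
      ⟨by linarith [hr3.2], by linarith [hr3.1]⟩
    rwa [hflow r hr1]

theorem isOpen_flowDomain
    (hv : ContMDiff I I.tangent 1 (fun x => (⟨x, v x⟩ : TangentBundle I M))) :
    IsOpen (flowDomain v) :=
  isOpen_iff_mem_nhds.mpr fun p hp =>
    (flowDomain_mem_nhds_and_continuousAt hv (t := p.1) (x := p.2) hp).1

theorem continuousAt_flow
    (hv : ContMDiff I I.tangent 1 (fun x => (⟨x, v x⟩ : TangentBundle I M)))
    {p : ℝ × M} (h : p ∈ flowDomain v) : ContinuousAt (flow v) p :=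
  (flowDomain_mem_nhds_and_continuousAt hv (t := p.1) (x := p.2) h).2

/-- A forward trajectory agrees with the maximal flow. -/
theorem flow_eq_of_isMIntegralCurveOn_Ici
    (hv : ContMDiff I I.tangent 1 (fun x => (⟨x, v x⟩ : TangentBundle I M)))
    {γ : ℝ → M} {x : M} (hγ0 : γ 0 = x) (hγ : IsMIntegralCurveOn γ v (Ici 0)) {t : ℝ}
    (ht : 0 ≤ t) : (t, x) ∈ flowDomain v ∧ flow v (t, x) = γ t := by
  obtain ⟨U, hU, ε, hε, hsub, -⟩ := exists_nhds_flow hv x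
  have hxU := mem_of_mem_nhds hU
  -- Prolonging γ to negative times by the flow gives a curve on an open interval around 0. At 0 the
  -- one-sided derivatives agree.
  set γ' : ℝ → M := fun s => if s < 0 then flow v (s, x) else γ s with hγ'
  have hpos : ∀ s, 0 ≤ s → γ' s = γ s := fun s hs => if_neg (not_lt.mpr hs)
  have hnonpos : ∀ s, s ≤ 0 → γ' s = flow v (s, x) := by
    intro s hs
    rcases hs.lt_or_eq with h | rfl
    · exact if_pos h
    · rw [hpos 0 le_rfl, hγ0, flow_zero hv]
  have hint : IsMIntegralCurveOn γ' v (Ioo (-ε) (t + 1)) := by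
    intro s hs
    apply HasMFDerivAt.hasMFDerivWithinAt
    have hright : 0 ≤ s → HasMFDerivWithinAt 𝓘(ℝ, ℝ) I γ' (Ici 0) s
        ((1 : ℝ →L[ℝ] ℝ).smulRight (v (γ' s))) := fun h => by
      rw [hpos s h]
      exact HasMFDerivWithinAt.congr_mono (hγ s h) (fun r hr => hpos r hr) (hpos s h) Subset.rfl
    have hleft : s ≤ 0 → HasMFDerivWithinAt 𝓘(ℝ, ℝ) I γ' (Iic 0) s
        ((1 : ℝ →L[ℝ] ℝ).smulRight (v (γ' s))) := fun h => by
      rw [hnonpos s h]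
      have hmem : (s, x) ∈ flowDomain v := hsub ⟨⟨hs.1, h.trans_lt hε⟩, hxU⟩
      exact (isMIntegralCurveAt_flow hv hmem).hasMFDerivAt.hasMFDerivWithinAt.congr_mono
        (fun r hr => hnonpos r hr) (hnonpos s h) Subset.rfl
    rcases lt_trichotomy s 0 with h | rfl | h
    · exact (hleft h.le).hasMFDerivAt (Iic_mem_nhds h)
    · have := (hleft le_rfl).union (hright le_rfl)
      rw [Iic_union_Ici] at this
      exact this.hasMFDerivAt univ_mem
    · exact (hright h.le).hasMFDerivAt (Ici_mem_nhds h)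
  have h0 : (0 : ℝ) ∈ Ioo (-ε) (t + 1) := ⟨by linarith, by linarith⟩
  have ht' : t ∈ Ioo (-ε) (t + 1) := ⟨by linarith, by linarith⟩
  have hx : γ' 0 = x := (hpos 0 le_rfl).trans hγ0
  exact ⟨mem_flowDomain h0 ht' hx hint, (flow_eq hv h0 ht' hx hint).trans (hpos t ht)⟩

end Flow

/-! ### Cramer's rule for Gram matrices -/

section Gram

/-- This is G · adj G = det G · 1, free of division and so valid for dependent vectors too. It
solves for a vector with prescribed inner products. -/
theorem inner_sum_adjugate_gram {V ι : Type*} [NormedAddCommGroup V] [InnerProductSpace ℝ V]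
    [Fintype ι] [DecidableEq ι] (v : ι → V) (a : ι → ℝ) (k : ι) :
    inner ℝ (v k) (∑ i, (∑ j, (Matrix.gram ℝ v).adjugate i j * a j) • v i) =
      (Matrix.gram ℝ v).det * a k := by
  have h := congrFun (congrArg (fun A => Matrix.mulVec A a)
    (Matrix.mul_adjugate (Matrix.gram ℝ v))) k
  simp only [Matrix.smul_mulVec, Matrix.one_mulVec, Pi.smul_apply, smul_eq_mul] at h
  rw [← h, ← Matrix.mulVec_mulVec, inner_sum, Matrix.mulVec, dotProduct]
  refine Finset.sum_congr rfl fun i _ => ?_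
  rw [inner_smul_right, Matrix.gram_apply, mul_comm]
  rfl

end Gram

/-! ### Smoothness of determinant and adjugate -/

section MatrixSmooth

variable {E : Type*} [NormedAddCommGroup E] [NormedSpace ℝ E]
  {H : Type*} [TopologicalSpace H] {I : ModelWithCorners ℝ E H}
  {M : Type*} [TopologicalSpace M] [ChartedSpace H M] {r : WithTop ℕ∞}
  {ι : Type*} [Fintype ι] [DecidableEq ι]

theorem contMDiffAt_matrix_det {A : M → Matrix ι ι ℝ} {x : M}
    (hA : ∀ i j, ContMDiffAt I 𝓘(ℝ, ℝ) r (fun y => A y i j) x) :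
    ContMDiffAt I 𝓘(ℝ, ℝ) r (fun y => (A y).det) x := by
  simp only [Matrix.det_apply']
  exact contMDiffAt_finsetSum fun σ _ => contMDiffAt_const.mul
    (contMDiffAt_finsetProd fun i _ => hA _ _)

theorem contMDiffAt_matrix_adjugate {A : M → Matrix ι ι ℝ} {x : M}
    (hA : ∀ i j, ContMDiffAt I 𝓘(ℝ, ℝ) r (fun y => A y i j) x) (i j : ι) :
    ContMDiffAt I 𝓘(ℝ, ℝ) r (fun y => (A y).adjugate i j) x := by
  simp only [Matrix.adjugate_apply]
  refine contMDiffAt_matrix_det fun k l => ?_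
  simp only [Matrix.updateRow_apply]
  split_ifs
  · exact contMDiffAt_const
  · exact hA k l

end MatrixSmooth

/-! ### The gradient of a C^2 function is C^1 -/

section Gradient

variable {n : ℕ} {M : Type*} [TopologicalSpace M] [ChartedSpace (EuclideanSpace ℝ (Fin n)) M]
  [IsManifold (𝓡 n) ∞ M]

theorem contMDiffAt_mfderiv_section {f : M → ℝ} (hf : ContMDiff (𝓡 n) 𝓘(ℝ, ℝ) 2 f)
    {s : (x : M) → TangentSpace (𝓡 n) x} {x : M}
    (hs : ContMDiffAt (𝓡 n) (𝓡 n).tangent 1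
      (fun x => (⟨x, s x⟩ : TangentBundle (𝓡 n) M)) x) :
    ContMDiffAt (𝓡 n) 𝓘(ℝ, ℝ) 1
      (fun y => (mfderiv (𝓡 n) 𝓘(ℝ, ℝ) f y : TangentSpace (𝓡 n) y →L[ℝ] ℝ) (s y)) x := by
  have h1 : ContMDiff (𝓡 n).tangent 𝓘(ℝ, ℝ).tangent 1 (tangentMap (𝓡 n) 𝓘(ℝ, ℝ) f) :=
    hf.contMDiff_tangentMap (by norm_num)
  exact (contMDiff_snd_tangentBundle_modelSpace ℝ 𝓘(ℝ, ℝ)).contMDiffAt.comp x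
    (h1.contMDiffAt.comp x hs)

variable [RiemannianBundle (fun x : M => TangentSpace (𝓡 n) x)]
    [IsContMDiffRiemannianBundle (𝓡 n) ∞ (EuclideanSpace ℝ (Fin n))
      (fun x : M => TangentSpace (𝓡 n) x)]

theorem contMDiffAt_inner_section {s t : (x : M) → TangentSpace (𝓡 n) x} {x : M}
    (hs : ContMDiffAt (𝓡 n) (𝓡 n).tangent 1
      (fun x => (⟨x, s x⟩ : TangentBundle (𝓡 n) M)) x)
    (ht : ContMDiffAt (𝓡 n) (𝓡 n).tangent 1
      (fun x => (⟨x, t x⟩ : TangentBundle (𝓡 n) M)) x) :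
    ContMDiffAt (𝓡 n) 𝓘(ℝ, ℝ) 1 (fun y => (inner ℝ (s y) (t y) : ℝ)) x :=
  haveI : IsContMDiffRiemannianBundle (𝓡 n) 1 (EuclideanSpace ℝ (Fin n))
      (fun x : M => TangentSpace (𝓡 n) x) :=
    IsContMDiffRiemannianBundle.of_le (n := ∞) (by exact_mod_cast le_top)
  ContMDiffAt.inner_bundle (F := EuclideanSpace ℝ (Fin n))
    (E := fun x : M => TangentSpace (𝓡 n) x) hs ht

/-- The gradient of a `C^2` function is a `C^1` vector field. -/
theorem contMDiff_grad {f : M → ℝ} (hf : ContMDiff (𝓡 n) 𝓘(ℝ, ℝ) 2 f) :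
    ContMDiff (𝓡 n) (𝓡 n).tangent 1
      (fun x => (⟨x, GuidingField.grad f x⟩ : TangentBundle (𝓡 n) M)) := by
  intro x₀
  set e := trivializationAt (EuclideanSpace ℝ (Fin n)) (fun x : M => TangentSpace (𝓡 n) x) x₀
    with he
  have hx₀ : x₀ ∈ e.baseSet := mem_baseSet_trivializationAt _ _ x₀
  let b := (EuclideanSpace.basisFun (Fin n) ℝ).toBasis
  let s : Fin n → (x : M) → TangentSpace (𝓡 n) x := e.localFrame b
  have hs : ∀ i, ContMDiffAt (𝓡 n) (𝓡 n).tangent 1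
      (fun x => (⟨x, s i x⟩ : TangentBundle (𝓡 n) M)) x₀ := fun i =>
    contMDiffAt_localFrame_of_mem (I := 𝓡 n) 1 e b i hx₀
  -- In a local frame the coefficients of grad f solve a linear system with the Gram matrix of the
  -- frame; Cramer's rule shows that they are C^1.
  let G : M → Matrix (Fin n) (Fin n) ℝ := fun x => Matrix.gram ℝ (fun i => s i x)
  have hG : ∀ i j, ContMDiffAt (𝓡 n) 𝓘(ℝ, ℝ) 1 (fun y => G y i j) x₀ := fun i j =>
    contMDiffAt_inner_section (hs i) (hs j)
  let d : Fin n → M → ℝ := fun j x =>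
    (mfderiv (𝓡 n) 𝓘(ℝ, ℝ) f x : TangentSpace (𝓡 n) x →L[ℝ] ℝ) (s j x)
  have hd : ∀ j, ContMDiffAt (𝓡 n) 𝓘(ℝ, ℝ) 1 (d j) x₀ := fun j =>
    contMDiffAt_mfderiv_section hf (hs j)
  have hdet : ∀ x ∈ e.baseSet, (G x).det ≠ 0 := fun x hx => by
    refine Matrix.det_gram_ne_zero_iff_linearIndependent.mpr ?_
    exact (e.isLocalFrameOn_localFrame_baseSet (𝓡 n) 1 b).linearIndependent hx
  let c : Fin n → M → ℝ := fun i x => ((G x).det)⁻¹ * ∑ j, (G x).adjugate i j * d j x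
  have hc : ∀ i, ContMDiffAt (𝓡 n) 𝓘(ℝ, ℝ) 1 (c i) x₀ := fun i =>
    ((contMDiffAt_matrix_det hG).inv₀ (hdet x₀ hx₀)).mul
      (contMDiffAt_finsetSum fun j _ => (contMDiffAt_matrix_adjugate hG i j).mul (hd j))
  have hsum : ContMDiffAt (𝓡 n) (𝓡 n).tangent 1
      (fun x => (⟨x, ∑ i, c i x • s i x⟩ : TangentBundle (𝓡 n) M)) x₀ :=
    ContMDiffAt.sum_section (t := fun i x => c i x • s i x)
      fun i _ => (hc i).smul_section (hs i)
  refine hsum.congr_of_eventuallyEq ?_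
  filter_upwards [e.open_baseSet.mem_nhds hx₀] with x hx
  congr 1
  refine InnerProductSpace.ext_inner_left_basis
    ((e.isLocalFrameOn_localFrame_baseSet (𝓡 n) 1 b).toBasisAt hx) fun k => ?_
  rw [IsLocalFrameOn.toBasisAt_coe, real_inner_comm, GuidingField.inner_grad]
  have := inner_sum_adjugate_gram (fun i => s i x) (fun j => d j x) k
  have h2 : (∑ i, c i x • s i x) = ((G x).det)⁻¹ •
      ∑ i, (∑ j, (G x).adjugate i j * d j x) • s i x := by
    rw [Finset.smul_sum]
    exact Finset.sum_congr rfl fun i _ => by rw [smul_smul]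
  rw [h2, inner_smul_right]
  change d k x = _ * _
  rw [this, inv_mul_cancel_left₀ (hdet x hx)]

end Gradient

/-! ### Lifting vector fields to M × F, with F as parameter space -/

section Lift

variable {E : Type*} [NormedAddCommGroup E] [NormedSpace ℝ E]
  {H : Type*} [TopologicalSpace H] {I : ModelWithCorners ℝ E H}
  {M : Type*} [TopologicalSpace M] [ChartedSpace H M]
  {F : Type*} [NormedAddCommGroup F] [NormedSpace ℝ F]

/-- The lift of a vector field on `M` to a vector field on `M × F` tangent to the slices. -/
def liftField (F : Type*) [NormedAddCommGroup F] [NormedSpace ℝ F]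
    (X : (x : M) → TangentSpace I x) (p : M × F) : TangentSpace (I.prod 𝓘(ℝ, F)) p :=
  (X p.1, (0 : F))

theorem contMDiff_liftField [IsManifold I 1 M] {X : (x : M) → TangentSpace I x}
    (hX : ContMDiff I I.tangent 1 (fun x => (⟨x, X x⟩ : TangentBundle I M))) :
    ContMDiff (I.prod 𝓘(ℝ, F)) (I.prod 𝓘(ℝ, F)).tangent 1
      (fun p => (⟨p, liftField F X p⟩ : TangentBundle (I.prod 𝓘(ℝ, F)) (M × F))) := by
  have h0 : ContMDiff 𝓘(ℝ, F) 𝓘(ℝ, F).tangent 1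
      (fun x => (⟨x, 0⟩ : TangentBundle 𝓘(ℝ, F) F)) :=
    contMDiff_zeroSection ℝ (fun x : F => TangentSpace 𝓘(ℝ, F) x)
  exact (contMDiff_equivTangentBundleProd_symm (I := I) (M := M) (I' := 𝓘(ℝ, F)) (M' := F)).comp
    ((hX.comp contMDiff_fst).prodMk (h0.comp contMDiff_snd))

theorem liftField_eq_sum {ι : Type*} {t : Finset ι} {c : ι → ℝ}
    {X : (x : M) → TangentSpace I x} {Y : ι → (x : M) → TangentSpace I x} {p : M × F}
    (h : X p.1 = ∑ i ∈ t, c i • Y i p.1) :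
    liftField F X p = ∑ i ∈ t, c i • liftField F (Y i) p := by
  let L : TangentSpace I p.1 →ₗ[ℝ] TangentSpace (I.prod 𝓘(ℝ, F)) p := LinearMap.inl ℝ E F
  have hL : ∀ Z : (x : M) → TangentSpace I x, liftField F Z p = L (Z p.1) := fun Z => rfl
  simp only [hL]
  rw [h, map_sum]
  exact Finset.sum_congr rfl fun i _ => map_smul L _ _

theorem mfderiv_snd_liftField (X : (x : M) → TangentSpace I x) (p : M × F) :
    (mfderiv (I.prod 𝓘(ℝ, F)) 𝓘(ℝ, F) (Prod.snd : M × F → F) p :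
      TangentSpace (I.prod 𝓘(ℝ, F)) p →L[ℝ] F) (liftField F X p) = 0 := by
  rw [mfderiv_snd]
  rfl

theorem mfderiv_comp_fst_liftField (X : (x : M) → TangentSpace I x) (p : M × F) {f : M → ℝ}
    (hf : MDifferentiableAt I 𝓘(ℝ, ℝ) f p.1) :
    (mfderiv (I.prod 𝓘(ℝ, F)) 𝓘(ℝ, ℝ) (fun q : M × F => f q.1) p :
      TangentSpace (I.prod 𝓘(ℝ, F)) p →L[ℝ] ℝ) (liftField F X p) =
    (mfderiv I 𝓘(ℝ, ℝ) f p.1 : TangentSpace I p.1 →L[ℝ] ℝ) (X p.1) := by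
  have h := mfderiv_comp (I := I.prod 𝓘(ℝ, F)) (I' := I) (I'' := 𝓘(ℝ, ℝ)) p (g := f)
    (f := Prod.fst) hf mdifferentiableAt_fst
  change (mfderiv (I.prod 𝓘(ℝ, F)) 𝓘(ℝ, ℝ) (f ∘ Prod.fst) p :
      TangentSpace (I.prod 𝓘(ℝ, F)) p →L[ℝ] ℝ) (liftField F X p) = _
  rw [h, mfderiv_fst]
  rfl

end Lift

/-! ### Vector fields moving e in a prescribed direction -/

section Transversal

variable {n m : ℕ} {M : Type*} [TopologicalSpace M] [ChartedSpace (EuclideanSpace ℝ (Fin n)) M]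

theorem contMDiff_component {e : M → EuclideanSpace ℝ (Fin m)}
    (he : ContMDiff (𝓡 n) 𝓘(ℝ, EuclideanSpace ℝ (Fin m)) 2 e) (i : Fin m) :
    ContMDiff (𝓡 n) 𝓘(ℝ, ℝ) 2 (fun y => e y i) :=
  (EuclideanSpace.proj (𝕜 := ℝ) i).contMDiff.comp he

theorem mfderiv_component {e : M → EuclideanSpace ℝ (Fin m)} {x : M}
    (he : MDifferentiableAt (𝓡 n) 𝓘(ℝ, EuclideanSpace ℝ (Fin m)) e x) (i : Fin m)
    (w : TangentSpace (𝓡 n) x) :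
    (mfderiv (𝓡 n) 𝓘(ℝ, ℝ) (fun y => e y i) x : TangentSpace (𝓡 n) x →L[ℝ] ℝ) w =
      EuclideanSpace.proj (𝕜 := ℝ) i ((mfderiv (𝓡 n) 𝓘(ℝ, EuclideanSpace ℝ (Fin m)) e x :
        TangentSpace (𝓡 n) x →L[ℝ] EuclideanSpace ℝ (Fin m)) w) := by
  have h := (((EuclideanSpace.proj (𝕜 := ℝ) i).hasFDerivAt (x := e x)).hasMFDerivAt.comp x
    he.hasMFDerivAt).mfderiv
  change (mfderiv (𝓡 n) 𝓘(ℝ, ℝ) (EuclideanSpace.proj (𝕜 := ℝ) i ∘ e) x :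
    TangentSpace (𝓡 n) x →L[ℝ] ℝ) w = _
  rw [h]
  rfl

variable [RiemannianBundle (fun x : M => TangentSpace (𝓡 n) x)]

/-- The gradients of the components of `e`. -/
def gradFamily (e : M → EuclideanSpace ℝ (Fin m)) (x : M) (i : Fin m) : TangentSpace (𝓡 n) x :=
  GuidingField.grad (fun y => e y i) x

/-- The Gram matrix of the gradients of the components of `e`. -/
def gradGram (n : ℕ) {M : Type*} [TopologicalSpace M] [ChartedSpace (EuclideanSpace ℝ (Fin n)) M]
    [RiemannianBundle (fun x : M => TangentSpace (𝓡 n) x)]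
    (e : M → EuclideanSpace ℝ (Fin m)) (x : M) : Matrix (Fin m) (Fin m) ℝ :=
  Matrix.gram ℝ (fun i => (gradFamily e x i : TangentSpace (𝓡 n) x))

theorem inner_gradFamily {e : M → EuclideanSpace ℝ (Fin m)} {x : M}
    (he : MDifferentiableAt (𝓡 n) 𝓘(ℝ, EuclideanSpace ℝ (Fin m)) e x) (i : Fin m)
    (w : TangentSpace (𝓡 n) x) :
    inner ℝ (gradFamily e x i) w = EuclideanSpace.proj (𝕜 := ℝ) i
      ((mfderiv (𝓡 n) 𝓘(ℝ, EuclideanSpace ℝ (Fin m)) e x :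
        TangentSpace (𝓡 n) x →L[ℝ] EuclideanSpace ℝ (Fin m)) w) := by
  rw [gradFamily, GuidingField.inner_grad, mfderiv_component he]

/-- If Σ c_i grad e_i = 0, pair it with a vector w such that de(w) = c: this gives Σ c_i² = 0. -/
theorem det_gradGram_pos {e : M → EuclideanSpace ℝ (Fin m)} {x : M}
    (he : MDifferentiableAt (𝓡 n) 𝓘(ℝ, EuclideanSpace ℝ (Fin m)) e x)
    (hsurj : Function.Surjective (mfderiv (𝓡 n) 𝓘(ℝ, EuclideanSpace ℝ (Fin m)) e x)) :
    0 < (gradGram n e x).det := by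
  have hli : LinearIndependent ℝ (fun i => (gradFamily e x i : TangentSpace (𝓡 n) x)) := by
    rw [Fintype.linearIndependent_iff]
    intro c hc
    obtain ⟨w, hw⟩ := hsurj (WithLp.toLp 2 c)
    have h0 : inner ℝ (∑ i, c i • (gradFamily e x i : TangentSpace (𝓡 n) x)) w = 0 := by
      rw [hc, inner_zero_left]
    have h1 : ∀ i, inner ℝ (gradFamily e x i) w = c i := fun i => by
      rw [inner_gradFamily he]
      exact congrArg (fun z : EuclideanSpace ℝ (Fin m) => z i) hw
    simp only [sum_inner, inner_smul_left, h1] at h0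
    intro i
    have := (Finset.sum_eq_zero_iff_of_nonneg (fun i _ => mul_self_nonneg (c i))).mp h0 i
      (Finset.mem_univ i)
    exact mul_self_eq_zero.mp this
  exact (Matrix.posDef_gram_of_linearIndependent hli).det_pos

theorem sum_smul_gradFamily_ne_zero {e : M → EuclideanSpace ℝ (Fin m)} {x : M}
    (hdet : (gradGram n e x).det ≠ 0) (hx : e x ≠ 0) :
    (∑ i, e x i • (gradFamily e x i : TangentSpace (𝓡 n) x)) ≠ 0 := by
  intro h
  have hli := Matrix.linearIndependent_of_det_gram_ne_zero hdet
  rw [Fintype.linearIndependent_iff] at hli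
  exact hx (by ext i; exact hli _ h i)

variable [IsManifold (𝓡 n) ∞ M] [IsContMDiffRiemannianBundle (𝓡 n) ∞ (EuclideanSpace ℝ (Fin n))
      (fun x : M => TangentSpace (𝓡 n) x)]

theorem contMDiff_gradFamily {e : M → EuclideanSpace ℝ (Fin m)}
    (he : ContMDiff (𝓡 n) 𝓘(ℝ, EuclideanSpace ℝ (Fin m)) 2 e) (i : Fin m) :
    ContMDiff (𝓡 n) (𝓡 n).tangent 1
      (fun x => (⟨x, gradFamily e x i⟩ : TangentBundle (𝓡 n) M)) :=
  contMDiff_grad (contMDiff_component he i)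

theorem contMDiff_gradGram {e : M → EuclideanSpace ℝ (Fin m)}
    (he : ContMDiff (𝓡 n) 𝓘(ℝ, EuclideanSpace ℝ (Fin m)) 2 e) (i j : Fin m) :
    ContMDiff (𝓡 n) 𝓘(ℝ, ℝ) 1 (fun x => gradGram n e x i j) := fun x =>
  contMDiffAt_inner_section (contMDiff_gradFamily he i x) (contMDiff_gradFamily he j x)

theorem continuous_det_gradGram {e : M → EuclideanSpace ℝ (Fin m)}
    (he : ContMDiff (𝓡 n) 𝓘(ℝ, EuclideanSpace ℝ (Fin m)) 2 e) :
    Continuous (fun x => (gradGram n e x).det) := by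
  have : ContMDiff (𝓡 n) 𝓘(ℝ, ℝ) 1 (fun x => (gradGram n e x).det) := fun x =>
    contMDiffAt_matrix_det fun i j => contMDiff_gradGram he i j x
  exact this.continuous

/-- A `C^1` function on the real line which is equal to `1 / d` for `d ≥ d₀`. -/
def smoothInv (d₀ d : ℝ) : ℝ := d / (d ^ 2 + expNegInvGlue (d₀ - d))

/-- The denominator never vanishes: d² is positive off 0, and the glue term is positive at 0 because
d₀ > 0. -/
theorem contDiff_smoothInv {d₀ : ℝ} (h : 0 < d₀) : ContDiff ℝ 1 (smoothInv d₀) := by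
  refine contDiff_id.div ((contDiff_id.pow 2).add
    (expNegInvGlue.contDiff.comp (contDiff_const.sub contDiff_id))) fun d => ?_
  rcases eq_or_ne d 0 with rfl | hd
  · have := expNegInvGlue.pos_of_pos (x := d₀ - 0) (by simpa using h)
    simpa using this.ne'
  · have := expNegInvGlue.nonneg (d₀ - d)
    have h2 : 0 < d ^ 2 := by positivity
    exact (add_pos_of_pos_of_nonneg h2 this).ne'

theorem smoothInv_mul_self {d₀ d : ℝ} (h : 0 < d₀) (hd : d₀ ≤ d) : smoothInv d₀ d * d = 1 := by
  have hd' : d ≠ 0 := (h.trans_le hd).ne'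
  rw [smoothInv, expNegInvGlue.zero_of_nonpos (by linarith), add_zero]
  field_simp

/-- The coefficients of `transversalField` in terms of the gradients. -/
def transversalCoeff (n : ℕ) {M : Type*} [TopologicalSpace M]
    [ChartedSpace (EuclideanSpace ℝ (Fin n)) M]
    [RiemannianBundle (fun x : M => TangentSpace (𝓡 n) x)]
    (e : M → EuclideanSpace ℝ (Fin m)) (d₀ : ℝ) (v : EuclideanSpace ℝ (Fin m)) (x : M)
    (i : Fin m) : ℝ :=
  smoothInv d₀ (gradGram n e x).det * ∑ j, (gradGram n e x).adjugate i j * v j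

/-- A vector field on `M`, linear in `v`, whose derivative of `e` is the vector `v` wherever
the Gram determinant is at least `d₀`. -/
def transversalField (e : M → EuclideanSpace ℝ (Fin m)) (d₀ : ℝ) (v : EuclideanSpace ℝ (Fin m))
    (x : M) : TangentSpace (𝓡 n) x :=
  ∑ i, transversalCoeff n e d₀ v x i • gradFamily e x i

omit [IsManifold (𝓡 n) ∞ M] [IsContMDiffRiemannianBundle (𝓡 n) ∞ (EuclideanSpace ℝ (Fin n))
      (fun x : M => TangentSpace (𝓡 n) x)] in
theorem inner_gradFamily_transversalField {e : M → EuclideanSpace ℝ (Fin m)} {d₀ : ℝ}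
    (hd₀ : 0 < d₀) (v : EuclideanSpace ℝ (Fin m)) {x : M} (hx : d₀ ≤ (gradGram n e x).det)
    (k : Fin m) :
    inner ℝ (gradFamily e x k : TangentSpace (𝓡 n) x) (transversalField e d₀ v x) = v k := by
  have h : transversalField e d₀ v x = smoothInv d₀ (gradGram n e x).det •
      ∑ i, (∑ j, (gradGram n e x).adjugate i j * v j) •
        (gradFamily e x i : TangentSpace (𝓡 n) x) := by
    rw [transversalField, Finset.smul_sum]
    exact Finset.sum_congr rfl fun i _ => by rw [smul_smul, transversalCoeff]
  rw [h, inner_smul_right, gradGram, inner_sum_adjugate_gram (fun i => gradFamily e x i), ← mul_assoc]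
  change smoothInv d₀ (gradGram n e x).det * (gradGram n e x).det * _ = _
  rw [smoothInv_mul_self hd₀ hx, one_mul]

/-- The family `transversalField e d₀ v` as one vector field on `M × ℝᵐ`. -/
def tubeField (e : M → EuclideanSpace ℝ (Fin m)) (d₀ : ℝ) (p : M × EuclideanSpace ℝ (Fin m)) :
    TangentSpace ((𝓡 n).prod 𝓘(ℝ, EuclideanSpace ℝ (Fin m))) p :=
  liftField (EuclideanSpace ℝ (Fin m)) (transversalField e d₀ p.2) p

theorem contMDiff_tubeField {e : M → EuclideanSpace ℝ (Fin m)}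
    (he : ContMDiff (𝓡 n) 𝓘(ℝ, EuclideanSpace ℝ (Fin m)) 2 e) {d₀ : ℝ} (hd₀ : 0 < d₀) :
    ContMDiff ((𝓡 n).prod 𝓘(ℝ, EuclideanSpace ℝ (Fin m)))
      ((𝓡 n).prod 𝓘(ℝ, EuclideanSpace ℝ (Fin m))).tangent 1
      (fun p => (⟨p, tubeField e d₀ p⟩ : TangentBundle
        ((𝓡 n).prod 𝓘(ℝ, EuclideanSpace ℝ (Fin m))) (M × EuclideanSpace ℝ (Fin m)))) := by
  have hcoeff : ∀ i, ContMDiff ((𝓡 n).prod 𝓘(ℝ, EuclideanSpace ℝ (Fin m))) 𝓘(ℝ, ℝ) 1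
      (fun p : M × EuclideanSpace ℝ (Fin m) => transversalCoeff n e d₀ p.2 p.1 i) := by
    intro i p
    have hdet : ContMDiffAt (𝓡 n) 𝓘(ℝ, ℝ) 1 (fun x => (gradGram n e x).det) p.1 :=
      contMDiffAt_matrix_det fun i j => contMDiff_gradGram he i j _
    have hadj : ∀ j, ContMDiffAt (𝓡 n) 𝓘(ℝ, ℝ) 1 (fun x => (gradGram n e x).adjugate i j) p.1 :=
      fun j => contMDiffAt_matrix_adjugate (fun i j => contMDiff_gradGram he i j _) i j
    refine ContMDiffAt.mul ?_ (contMDiffAt_finsetSum fun j _ => ContMDiffAt.mul ?_ ?_)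
    · exact (contDiff_smoothInv hd₀).contMDiff.contMDiffAt.comp p (hdet.comp p contMDiffAt_fst)
    · exact (hadj j).comp p contMDiffAt_fst
    · exact (EuclideanSpace.proj (𝕜 := ℝ) j).contMDiff.contMDiffAt.comp p contMDiffAt_snd
  have hsum := ContMDiff.sum_section (s := Finset.univ)
    (t := fun i (p : M × EuclideanSpace ℝ (Fin m)) => transversalCoeff n e d₀ p.2 p.1 i •
      liftField (EuclideanSpace ℝ (Fin m)) (fun x => gradFamily e x i) p)
    fun i _ => (hcoeff i).smul_section
      (contMDiff_liftField (F := EuclideanSpace ℝ (Fin m)) (contMDiff_gradFamily he i))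
  have hEq : ∀ p : M × EuclideanSpace ℝ (Fin m), tubeField e d₀ p =
      ∑ i, transversalCoeff n e d₀ p.2 p.1 i •
        liftField (EuclideanSpace ℝ (Fin m)) (fun x => gradFamily e x i) p := fun p =>
    liftField_eq_sum rfl
  simp only [hEq]
  exact hsum

end Transversal

/-! ### The trivial tube around K -/

section Tube

variable {n m : ℕ} {M : Type*} [TopologicalSpace M] [T2Space M]
  [ChartedSpace (EuclideanSpace ℝ (Fin n)) M]
  [IsManifold (𝓡 n) ∞ M] [RiemannianBundle (fun x : M => TangentSpace (𝓡 n) x)]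
  [IsContMDiffRiemannianBundle (𝓡 n) ∞ (EuclideanSpace ℝ (Fin n))
      (fun x : M => TangentSpace (𝓡 n) x)]

theorem eq_of_hasDerivAt_zero_uIcc {F : Type*} [NormedAddCommGroup F] [NormedSpace ℝ F]
    {f : ℝ → F} {a b : ℝ} (h : ∀ s ∈ uIcc a b, HasDerivAt f 0 s) : f b = f a := by
  have := (convex_uIcc a b).norm_image_sub_le_of_norm_hasDerivWithin_le (f := f) (C := 0)
    (fun s hs => (h s hs).hasDerivWithinAt) (fun s _ => by simp) left_mem_uIcc right_mem_uIcc
  rw [zero_mul, norm_le_zero_iff] at this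
  exact sub_eq_zero.mp this

theorem flow_tubeField_snd {e : M → EuclideanSpace ℝ (Fin m)}
    (he : ContMDiff (𝓡 n) 𝓘(ℝ, EuclideanSpace ℝ (Fin m)) 2 e) {d₀ : ℝ} (hd₀ : 0 < d₀)
    {t : ℝ} {p : M × EuclideanSpace ℝ (Fin m)}
    (h : (t, p) ∈ flowDomain (tubeField (n := n) e d₀)) :
    (flow (tubeField (n := n) e d₀) (t, p)).2 = p.2 := by
  have hw := contMDiff_tubeField (n := n) he hd₀
  have h1 := eq_of_hasDerivAt_zero_uIcc (f := fun s => (flow (tubeField (n := n) e d₀) (s, p)).2)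
    (a := 0) (b := t) fun s hs => by
      have := hasDerivAt_comp_flow hw (flowDomain_uIcc h hs) (f := Prod.snd)
        mdifferentiableAt_snd
      exact this.congr_deriv (mfderiv_snd_liftField _ _)
  rw [h1, flow_zero hw]

/-- While the determinant stays at least d₀, e moves with the constant velocity p.2. -/
theorem flow_tubeField_fst {e : M → EuclideanSpace ℝ (Fin m)}
    (he : ContMDiff (𝓡 n) 𝓘(ℝ, EuclideanSpace ℝ (Fin m)) 2 e) {d₀ : ℝ} (hd₀ : 0 < d₀)
    {t : ℝ} {p : M × EuclideanSpace ℝ (Fin m)}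
    (h : (t, p) ∈ flowDomain (tubeField (n := n) e d₀))
    (hdet : ∀ s ∈ uIcc 0 t,
      d₀ ≤ (gradGram n e (flow (tubeField (n := n) e d₀) (s, p)).1).det) :
    e (flow (tubeField (n := n) e d₀) (t, p)).1 = e p.1 + t • p.2 := by
  have hw := contMDiff_tubeField (n := n) he hd₀
  ext k
  have h1 := eq_of_hasDerivAt_zero_uIcc
    (f := fun s => e (flow (tubeField (n := n) e d₀) (s, p)).1 k - s * p.2 k)
    (a := 0) (b := t) fun s hs => by
      have hek : MDifferentiable (𝓡 n) 𝓘(ℝ, ℝ) (fun x => e x k) :=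
        (contMDiff_component he k).mdifferentiable (by norm_num)
      have h2 := hasDerivAt_comp_flow hw (flowDomain_uIcc h hs)
        (f := fun q : M × EuclideanSpace ℝ (Fin m) => e q.1 k)
        ((hek _).comp _ mdifferentiableAt_fst)
      have h3 : HasDerivAt (fun s => e (flow (tubeField (n := n) e d₀) (s, p)).1 k) (p.2 k) s := by
        refine h2.congr_deriv ((mfderiv_comp_fst_liftField _ _ (hek _)).trans ?_)
        rw [← GuidingField.inner_grad]
        refine (inner_gradFamily_transversalField hd₀ _ (hdet s hs) k).trans ?_
        rw [flow_tubeField_snd he hd₀ (flowDomain_uIcc h hs)]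
      exact (h3.sub ((hasDerivAt_id s).mul_const (p.2 k))).congr_deriv (by rw [one_mul, sub_self])
  rw [flow_zero hw, zero_mul, sub_zero] at h1
  simp only [PiLp.add_apply, PiLp.smul_apply, smul_eq_mul]
  linarith

/-- The field vanishes for parameter 0, so these points are fixed. Compactness then controls
unit-time trajectories for small parameters. -/
theorem flow_tubeField_zero {e : M → EuclideanSpace ℝ (Fin m)}
    (he : ContMDiff (𝓡 n) 𝓘(ℝ, EuclideanSpace ℝ (Fin m)) 2 e) {d₀ : ℝ} (hd₀ : 0 < d₀)
    (t : ℝ) (x : M) :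
    (t, (x, (0 : EuclideanSpace ℝ (Fin m)))) ∈ flowDomain (tubeField (n := n) e d₀) ∧
      flow (tubeField (n := n) e d₀) (t, (x, 0)) = (x, 0) := by
  have hz : tubeField (n := n) e d₀ (x, 0) = 0 := by
    have : transversalField (n := n) e d₀ 0 x = 0 := by
      simp [transversalField, transversalCoeff]
    change (transversalField (n := n) e d₀ 0 x, (0 : EuclideanSpace ℝ (Fin m))) = 0
    rw [this]
    rfl
  have hcurve := (isMIntegralCurve_const hz).isMIntegralCurveOn (Ioo (-(|t| + 1)) (|t| + 1))
  have h0 : (0 : ℝ) ∈ Ioo (-(|t| + 1)) (|t| + 1) := by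
    constructor <;> linarith [abs_nonneg t]
  have ht : t ∈ Ioo (-(|t| + 1)) (|t| + 1) := by
    constructor <;> linarith [neg_abs_le t, le_abs_self t]
  exact ⟨mem_flowDomain h0 ht rfl hcurve,
    flow_eq (contMDiff_tubeField he hd₀) h0 ht rfl hcurve⟩

/-- A compact regular zero level has a trivial tubular neighbourhood in which the second
coordinate is `e`. -/
theorem exists_tube {e : M → EuclideanSpace ℝ (Fin m)}
    (he : ContMDiff (𝓡 n) 𝓘(ℝ, EuclideanSpace ℝ (Fin m)) 2 e)
    (hK : IsCompact (GuidingField.zeroLevel e)) (hreg : GuidingField.IsRegularZeroLevel n e)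
    {A₀ : Set M} (hA₀ : IsOpen A₀) (hKA₀ : GuidingField.zeroLevel e ⊆ A₀) :
    ∃ (A : Set M) (c : ℝ) (h : M × EuclideanSpace ℝ (Fin m) → M) (ρ : M → M),
      IsOpen A ∧ GuidingField.zeroLevel e ⊆ A ∧ A ⊆ A₀ ∧ 0 < c ∧
      (∀ x ∈ A, (gradGram n e x).det ≠ 0) ∧
      IsCompact (A ∩ {x | ‖e x‖ ≤ c}) ∧
      ContinuousOn h (GuidingField.zeroLevel e ×ˢ Metric.closedBall 0 c) ∧
      ContinuousOn ρ (A ∩ {x | ‖e x‖ ≤ c}) ∧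
      (∀ p ∈ GuidingField.zeroLevel e, ∀ v, ‖v‖ ≤ c →
        h (p, v) ∈ A ∧ e (h (p, v)) = v ∧ ρ (h (p, v)) = p) ∧
      (∀ q ∈ A, ‖e q‖ ≤ c → ρ q ∈ GuidingField.zeroLevel e ∧ h (ρ q, e q) = q) := by
  set K := GuidingField.zeroLevel e with hKdef
  have hdetc := continuous_det_gradGram (n := n) he
  have hed : MDifferentiable (𝓡 n) 𝓘(ℝ, EuclideanSpace ℝ (Fin m)) e :=
    he.mdifferentiable (by norm_num)
  obtain ⟨d₁, hd₁, hKd⟩ := hK.exists_forall_le' hdetc.continuousOn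
    (fun x hx => det_gradGram_pos (hed x) (hreg x hx))
  -- The gap below the minimum d₁ on K makes `d₀ < det` an open condition satisfied along K.
  obtain ⟨d₀, hd₀, hd01⟩ := exists_between hd₁
  have hw := contMDiff_tubeField (n := n) he hd₀
  set Φ := flow (tubeField (n := n) e d₀) with hΦ
  set Ω := flowDomain (tubeField (n := n) e d₀) with hΩ
  have hΦc : ContinuousOn Φ Ω := fun p hp => (continuousAt_flow hw hp).continuousWithinAt
  have hΩo : IsOpen Ω := isOpen_flowDomain hw
  have hS : IsOpen (Ω ∩ Φ ⁻¹' {q | d₀ < (gradGram n e q.1).det}) :=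
    hΦc.isOpen_inter_preimage hΩo (isOpen_lt continuous_const (hdetc.comp continuous_fst))
  have hsub : Icc (-1 : ℝ) 1 ×ˢ (K ×ˢ {(0 : EuclideanSpace ℝ (Fin m))}) ⊆
      Ω ∩ Φ ⁻¹' {q | d₀ < (gradGram n e q.1).det} := by
    rintro ⟨t, x, v⟩ ⟨-, hx, hv⟩
    obtain rfl : v = 0 := hv
    obtain ⟨h1, h2⟩ := flow_tubeField_zero he hd₀ t x
    refine ⟨h1, ?_⟩
    rw [mem_preimage, hΦ, h2]
    exact hd01.trans_le (hKd x hx)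
  -- Compactness of [-1, 1] × K × {0}: near K and for small v, trajectories exist for times in [-1,
  -- 1] and keep the determinant above d₀.
  obtain ⟨T, V, -, hV, hT, hKV, hTV⟩ := generalized_tube_lemma isCompact_Icc
    (hK.prod isCompact_singleton) hS hsub
  obtain ⟨A₁, B₁, hA₁, hB₁, hKA₁, h0B₁, hAB⟩ := generalized_tube_lemma hK isCompact_singleton hV hKV
  have hgood : ∀ x ∈ A₁, ∀ v ∈ B₁, ∀ t ∈ Icc (-1 : ℝ) 1,
      (t, (x, v)) ∈ Ω ∧ d₀ ≤ (gradGram n e (Φ (t, (x, v))).1).det := fun x hx v hv t ht =>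
    have h := hTV (mk_mem_prod (hT ht) (hAB (mk_mem_prod hx hv)))
    ⟨h.1, le_of_lt h.2⟩
  have hsnd : ∀ x ∈ A₁, ∀ v ∈ B₁, ∀ t ∈ Icc (-1 : ℝ) 1, (Φ (t, (x, v))).2 = v :=
    fun x hx v hv t ht => flow_tubeField_snd he hd₀ (hgood x hx v hv t ht).1
  have hfst : ∀ x ∈ A₁, ∀ v ∈ B₁, ∀ t ∈ Icc (-1 : ℝ) 1, e (Φ (t, (x, v))).1 = e x + t • v :=
    fun x hx v hv t ht => flow_tubeField_fst he hd₀ (hgood x hx v hv t ht).1 fun s hs =>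
      (hgood x hx v hv s (ordConnected_Icc.uIcc_subset ⟨by norm_num, by norm_num⟩ ht hs)).2
  have h1m : (1 : ℝ) ∈ Icc (-1 : ℝ) 1 := ⟨by norm_num, le_rfl⟩
  have hm1 : (-1 : ℝ) ∈ Icc (-1 : ℝ) 1 := ⟨le_rfl, by norm_num⟩
  let A := A₀ ∩ A₁ ∩ {x | 0 < (gradGram n e x).det}
  have hAo : IsOpen A := (hA₀.inter hA₁).inter (isOpen_lt continuous_const hdetc)
  have hKA : K ⊆ A := fun x hx => ⟨⟨hKA₀ hx, hKA₁ hx⟩, hd₁.trans_le (hKd x hx)⟩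
  let h : M × EuclideanSpace ℝ (Fin m) → M := fun q => (Φ (1, q)).1
  have hhc : ContinuousOn h (A₁ ×ˢ B₁) := by
    refine continuous_fst.comp_continuousOn (hΦc.comp (by fun_prop) ?_)
    rintro ⟨x, v⟩ ⟨hx, hv⟩
    exact (hgood x hx v hv 1 h1m).1
  have hO := hhc.isOpen_inter_preimage (hA₁.prod hB₁) hAo
  have hKO : K ×ˢ {(0 : EuclideanSpace ℝ (Fin m))} ⊆ A₁ ×ˢ B₁ ∩ h ⁻¹' A := by
    rintro ⟨x, v⟩ ⟨hx, hv⟩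
    obtain rfl : v = 0 := hv
    refine ⟨⟨hKA₁ hx, h0B₁ rfl⟩, ?_⟩
    have : h (x, 0) = x := by
      change (Φ (1, (x, 0))).1 = x
      rw [hΦ, (flow_tubeField_zero he hd₀ 1 x).2]
    rw [mem_preimage, this]
    exact hKA hx
  -- A second use of compactness makes h(p, v) land in A for every p in K and all small v.
  obtain ⟨A₂, B₂, -, hB₂, hKA₂, h0B₂, hAB₂⟩ := generalized_tube_lemma hK isCompact_singleton hO hKO
  obtain ⟨c, hc, hcB⟩ := Metric.nhds_basis_closedBall.mem_iff.mp
    (inter_mem (hB₁.mem_nhds (h0B₁ rfl)) (hB₂.mem_nhds (h0B₂ rfl)))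
  have hcB' : ∀ v : EuclideanSpace ℝ (Fin m), ‖v‖ ≤ c → v ∈ B₁ ∧ v ∈ B₂ := fun v hv =>
    hcB (mem_closedBall_zero_iff.mpr hv)
  -- On the tube e(h(p, v)) = v, so e q recovers the parameter; running its field backwards for unit
  -- time undoes h.
  let ρ : M → M := fun q => (Φ (-1, (q, e q))).1
  have hforward : ∀ p ∈ K, ∀ v, ‖v‖ ≤ c →
      h (p, v) ∈ A ∧ e (h (p, v)) = v ∧ ρ (h (p, v)) = p := by
    intro p hp v hv
    have hpA := hKA₁ hp
    have hvB := (hcB' v hv).1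
    have he1 : e (h (p, v)) = v := by
      change e (Φ (1, (p, v))).1 = v
      rw [hfst p hpA v hvB 1 h1m, one_smul, show e p = 0 from hp, zero_add]
    refine ⟨(hAB₂ (mk_mem_prod (hKA₂ hp) (hcB' v hv).2)).2, he1, ?_⟩
    have h2 : Φ (1, (p, v)) = (h (p, v), v) := Prod.ext rfl (hsnd p hpA v hvB 1 h1m)
    have h3 := (flow_neg hw (hgood p hpA v hvB 1 h1m).1).2
    change (Φ (-1, (h (p, v), e (h (p, v))))).1 = p
    rw [he1, ← h2, hΦ, h3]
  have hback : ∀ q ∈ A, ‖e q‖ ≤ c → ρ q ∈ K ∧ h (ρ q, e q) = q := by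
    intro q hq hqc
    have hqA : q ∈ A₁ := hq.1.2
    have hvB := (hcB' (e q) hqc).1
    refine ⟨?_, ?_⟩
    · change e (Φ (-1, (q, e q))).1 = 0
      rw [hfst q hqA (e q) hvB (-1) hm1, neg_one_smul, add_neg_cancel]
    · have h2 : Φ (-1, (q, e q)) = (ρ q, e q) := Prod.ext rfl (hsnd q hqA (e q) hvB (-1) hm1)
      have h3 := (flow_neg hw (hgood q hqA (e q) hvB (-1) hm1).1).2
      rw [neg_neg] at h3
      change (Φ (1, (ρ q, e q))).1 = q
      rw [← h2, hΦ, h3]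
  have hsubAB : K ×ˢ Metric.closedBall (0 : EuclideanSpace ℝ (Fin m)) c ⊆ A₁ ×ˢ B₁ :=
    prod_mono hKA₁ fun v hv => (hcB' v (mem_closedBall_zero_iff.mp hv)).1
  have himage : h '' (K ×ˢ Metric.closedBall 0 c) = A ∩ {x | ‖e x‖ ≤ c} := by
    ext q
    constructor
    · rintro ⟨⟨p, v⟩, ⟨hp, hv⟩, rfl⟩
      have hv' := mem_closedBall_zero_iff.mp hv
      obtain ⟨h1, h2, -⟩ := hforward p hp v hv'
      refine ⟨h1, ?_⟩
      rw [mem_ofPred_eq, h2]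
      exact hv'
    · rintro ⟨hq, hqc⟩
      obtain ⟨h1, h2⟩ := hback q hq hqc
      exact ⟨(ρ q, e q), ⟨h1, mem_closedBall_zero_iff.mpr hqc⟩, h2⟩
  refine ⟨A, c, h, ρ, hAo, hKA, fun x hx => hx.1.1, hc, fun x hx => ne_of_gt hx.2, ?_,
    hhc.mono hsubAB, ?_, hforward, hback⟩
  · rw [← himage]
    exact (hK.prod (isCompact_closedBall _ _)).image_of_continuousOn (hhc.mono hsubAB)
  · refine continuous_fst.comp_continuousOn (hΦc.comp ?_ ?_)
    · exact (continuous_const.prodMk (continuous_id.prodMk he.continuous)).continuousOn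
    · rintro q ⟨hq, hqc⟩
      exact (hgood q hq.1.2 (e q) (hcB' (e q) hqc).1 (-1) hm1).1

end Tube

/-! ### Stretching half-open time intervals to [0, ∞), continuously in the base point -/

section FiberRescaling

variable {Y : Type*} [EMetricSpace Y]

/-- The distance to `A`, truncated at `1`. -/
def truncDist (A : Set (Y × ℝ)) (z : Y × ℝ) : ℝ := (min 1 (Metric.infEDist z A)).toReal

/-- Truncation keeps the value finite, since `infEDist` is ⊤ when A is empty or infinitely far away.
-/
theorem continuous_truncDist (A : Set (Y × ℝ)) : Continuous (truncDist A) :=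
  ENNReal.continuousOn_toReal.comp_continuous
    (continuous_const.min Metric.continuous_infEDist) fun _ =>
      (min_lt_of_left_lt ENNReal.one_lt_top).ne

theorem truncDist_pos {A : Set (Y × ℝ)} (hA : IsClosed A) {z : Y × ℝ} (hz : z ∉ A) :
    0 < truncDist A z := by
  refine ENNReal.toReal_pos (ne_of_gt ?_) (min_lt_of_left_lt ENNReal.one_lt_top).ne
  refine lt_min one_pos (pos_iff_ne_zero.mpr fun h => hz ?_)
  exact (Metric.mem_iff_infEDist_zero_of_closed hA).mpr h

/-- Moving up by t' - t maps A into itself, so each competitor for the distance at t yields an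
equally distant one at t'. -/
theorem truncDist_antitone {A : Set (Y × ℝ)} (hshift : ∀ s t r, 0 ≤ r → (s, t) ∈ A → (s, t + r) ∈ A)
    (s : Y) {t t' : ℝ} (h : t ≤ t') : truncDist A (s, t') ≤ truncDist A (s, t) := by
  refine ENNReal.toReal_mono (min_lt_of_left_lt ENNReal.one_lt_top).ne (min_le_min le_rfl ?_)
  refine Metric.le_infEDist.mpr ?_
  rintro ⟨s', r⟩ hz
  refine (Metric.infEDist_le_edist_of_mem (hshift s' r (t' - t) (by linarith) hz)).trans_eq ?_
  rw [Prod.edist_eq, Prod.edist_eq]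
  simp only
  congr 1
  rw [edist_dist, edist_dist, Real.dist_eq, Real.dist_eq]
  congr 2
  ring

/-- A rescaling of the fibre coordinate which goes to infinity at `A`. -/
def fiberScale (A : Set (Y × ℝ)) (z : Y × ℝ) : ℝ :=
  z.2 + (truncDist A z)⁻¹ - (truncDist A (z.1, 0))⁻¹

theorem fiberScale_zero (A : Set (Y × ℝ)) (s : Y) : fiberScale A (s, 0) = 0 := by
  simp [fiberScale]

theorem continuousAt_fiberScale {A : Set (Y × ℝ)} (hA : IsClosed A) {z : Y × ℝ} (hz : z ∉ A)
    (hz0 : (z.1, (0 : ℝ)) ∉ A) : ContinuousAt (fiberScale A) z := by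
  have hc := continuous_truncDist A
  refine (continuousAt_snd.add (hc.continuousAt.inv₀ (truncDist_pos hA hz).ne')).sub
    (ContinuousAt.inv₀ ?_ (truncDist_pos hA hz0).ne')
  exact (hc.comp (by fun_prop : Continuous fun z : Y × ℝ => (z.1, (0 : ℝ)))).continuousAt

/-- The linear term contributes t' - t and the reciprocal distance does not decrease. Growth at rate
at least 1 gives injectivity on fibres. -/
theorem fiberScale_add_le {A : Set (Y × ℝ)} (hA : IsClosed A)
    (hshift : ∀ s t r, 0 ≤ r → (s, t) ∈ A → (s, t + r) ∈ A) {s : Y} {t t' : ℝ} (h : t ≤ t')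
    (ht' : (s, t') ∉ A) : fiberScale A (s, t) + (t' - t) ≤ fiberScale A (s, t') := by
  have := inv_anti₀ (truncDist_pos hA ht') (truncDist_antitone hshift s h)
  simp only [fiberScale]
  linarith

theorem exists_fiberScale_eq {A : Set (Y × ℝ)} (hA : IsClosed A)
    (hshift : ∀ s t r, 0 ≤ r → (s, t) ∈ A → (s, t + r) ∈ A) {s : Y} (hs : (s, (0 : ℝ)) ∉ A)
    {u : ℝ} (hu : 0 ≤ u) : ∃ t, 0 ≤ t ∧ (s, t) ∉ A ∧ fiberScale A (s, t) = u := by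
  obtain ⟨t₁, ht₁, ht₁A, hle⟩ : ∃ t₁, 0 ≤ t₁ ∧ (s, t₁) ∉ A ∧ u ≤ fiberScale A (s, t₁) := by
    by_cases hex : ∃ t, 0 ≤ t ∧ (s, t) ∈ A
    · set B : Set ℝ := {t | 0 ≤ t ∧ (s, t) ∈ A} with hB
      have hBc : IsClosed B := (isClosed_le continuous_const continuous_id).inter
        (hA.preimage (by fun_prop : Continuous fun t : ℝ => (s, t)))
      have hBb : BddBelow B := ⟨0, fun t ht => ht.1⟩
      have hT := hBc.csInf_mem hex hBb
      set T := sInf B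
      have hT0 : 0 < T := hT.1.lt_of_ne fun h => hs (h ▸ hT.2)
      set d := truncDist A (s, 0) with hd
      have hdpos : 0 < d := truncDist_pos hA hs
      -- At time T - η the distance to A is at most η, so its reciprocal is at least u + d⁻¹; the
      -- d⁻¹ offsets the normalisation at time 0.
      set η := min T (u + d⁻¹)⁻¹ with hη
      have hsum : 0 < u + d⁻¹ := by positivity
      have hη0 : 0 < η := lt_min hT0 (inv_pos.mpr hsum)
      have hηT : η ≤ T := min_le_left _ _
      have hnot : (s, T - η) ∉ A := fun hmem => by
        have := csInf_le hBb (show T - η ∈ B from ⟨by linarith, hmem⟩)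
        linarith
      refine ⟨T - η, by linarith, hnot, ?_⟩
      have h1 : truncDist A (s, T - η) ≤ η := by
        refine ENNReal.toReal_le_of_le_ofReal hη0.le ((min_le_right _ _).trans ?_)
        refine (Metric.infEDist_le_edist_of_mem hT.2).trans_eq ?_
        rw [Prod.edist_eq]
        simp [edist_dist, abs_of_pos hη0]
      have h2 : u + d⁻¹ ≤ (truncDist A (s, T - η))⁻¹ := by
        rw [← inv_inv (u + d⁻¹)]
        exact inv_anti₀ (truncDist_pos hA hnot) (h1.trans (min_le_right _ _))
      simp only [fiberScale]
      linarith
    · push Not at hex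
      -- If the fibre never meets A, the linear term alone reaches u.
      refine ⟨u, hu, hex u hu, ?_⟩
      have := fiberScale_add_le hA hshift hu (hex u hu)
      rw [fiberScale_zero] at this
      linarith
  have hnot : ∀ t ∈ Icc 0 t₁, (s, t) ∉ A := fun t ht h => ht₁A (by
    have := hshift s t (t₁ - t) (by linarith [ht.2]) h
    rwa [add_sub_cancel] at this)
  have hcont : ContinuousOn (fun t => fiberScale A (s, t)) (Icc 0 t₁) := fun t ht =>
    (ContinuousAt.comp (g := fiberScale A) (f := fun t : ℝ => (s, t))
      (continuousAt_fiberScale hA (hnot t ht) hs) (by fun_prop)).continuousWithinAt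
  obtain ⟨t, ht, hteq⟩ := intermediate_value_Icc ht₁ hcont
    (show u ∈ Icc (fiberScale A (s, 0)) (fiberScale A (s, t₁)) from
      ⟨by rw [fiberScale_zero]; exact hu, hle⟩)
  exact ⟨t, ht.1, hnot t ht, hteq⟩

open Classical in
/-- The fibrewise inverse of `fiberScale`. -/
def fiberUnscale (A : Set (Y × ℝ)) (z : Y × ℝ) : ℝ :=
  if h : ∃ t, 0 ≤ t ∧ (z.1, t) ∉ A ∧ fiberScale A (z.1, t) = z.2 then h.choose else 0

theorem fiberUnscale_spec {A : Set (Y × ℝ)} (hA : IsClosed A)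
    (hshift : ∀ s t r, 0 ≤ r → (s, t) ∈ A → (s, t + r) ∈ A) {s : Y} (hs : (s, (0 : ℝ)) ∉ A)
    {u : ℝ} (hu : 0 ≤ u) : 0 ≤ fiberUnscale A (s, u) ∧ (s, fiberUnscale A (s, u)) ∉ A ∧
      fiberScale A (s, fiberUnscale A (s, u)) = u := by
  have h := exists_fiberScale_eq hA hshift hs hu
  rw [fiberUnscale, dif_pos h]
  exact h.choose_spec

theorem fiberUnscale_fiberScale {A : Set (Y × ℝ)} (hA : IsClosed A)
    (hshift : ∀ s t r, 0 ≤ r → (s, t) ∈ A → (s, t + r) ∈ A) {s : Y} (hs : (s, (0 : ℝ)) ∉ A)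
    {t : ℝ} (ht : 0 ≤ t) (htA : (s, t) ∉ A) :
    0 ≤ fiberScale A (s, t) ∧ fiberUnscale A (s, fiberScale A (s, t)) = t := by
  have h0 : 0 ≤ fiberScale A (s, t) := by
    have := fiberScale_add_le hA hshift ht htA
    rw [fiberScale_zero] at this
    linarith
  obtain ⟨h1, h2, h3⟩ := fiberUnscale_spec hA hshift hs h0
  refine ⟨h0, le_antisymm (le_of_not_gt fun h => ?_) (le_of_not_gt fun h => ?_)⟩
  · have := fiberScale_add_le hA hshift h.le h2
    linarith
  · have := fiberScale_add_le hA hshift h.le htA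
    linarith

/-- By fibrewise monotonicity, bounds on the inverse amount to bounds on `fiberScale` at fixed
heights, which are open conditions in the base point. -/
theorem continuousOn_fiberUnscale {A : Set (Y × ℝ)} (hA : IsClosed A)
    (hshift : ∀ s t r, 0 ≤ r → (s, t) ∈ A → (s, t + r) ∈ A) {S : Set Y}
    (hS : ∀ s ∈ S, (s, (0 : ℝ)) ∉ A) : ContinuousOn (fiberUnscale A) (S ×ˢ Ici 0) := by
  rintro ⟨s₀, u₀⟩ ⟨hs₀, hu₀⟩
  obtain ⟨h1, h2, h3⟩ := fiberUnscale_spec hA hshift (hS s₀ hs₀) hu₀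
  set t₀ := fiberUnscale A (s₀, u₀) with ht₀
  have hcts : ∀ b, (s₀, b) ∉ A → ContinuousAt (fun z : Y × ℝ => fiberScale A (z.1, b)) (s₀, u₀) :=
    fun b hb => ContinuousAt.comp (g := fiberScale A) (f := fun z : Y × ℝ => (z.1, b))
      (continuousAt_fiberScale hA hb (hS s₀ hs₀)) (by fun_prop)
  refine tendsto_order.mpr ⟨fun a ha => ?_, fun b hb => ?_⟩
  · rcases lt_or_ge a 0 with ha0 | ha0
    · filter_upwards [self_mem_nhdsWithin] with z hz
      exact ha0.trans_le (fiberUnscale_spec hA hshift (hS z.1 hz.1) hz.2).1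
    · have haA : (s₀, a) ∉ A := fun h => h2 (by
        have := hshift s₀ a (t₀ - a) (by linarith) h
        rwa [add_sub_cancel] at this)
      have hlt : fiberScale A (s₀, a) < u₀ := by
        have := fiberScale_add_le hA hshift ha.le h2
        linarith
      have h4 : ∀ᶠ z : Y × ℝ in 𝓝 (s₀, u₀), fiberScale A (z.1, a) < z.2 :=
        (hcts a haA).eventually_lt continuousAt_snd hlt
      have h5 : ∀ᶠ z : Y × ℝ in 𝓝 (s₀, u₀), (z.1, a) ∉ A :=
        (by fun_prop : Continuous fun z : Y × ℝ => (z.1, a)).continuousAt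
          (x := (s₀, u₀)) (hA.isOpen_compl.mem_nhds haA)
      filter_upwards [self_mem_nhdsWithin, nhdsWithin_le_nhds h4, nhdsWithin_le_nhds h5]
        with z hz hz4 hz5
      obtain ⟨-, -, h6⟩ := fiberUnscale_spec hA hshift (hS z.1 hz.1) hz.2
      refine lt_of_not_ge fun hle => ?_
      have := fiberScale_add_le hA hshift hle hz5
      linarith
  -- The height b itself may lie in A, where `fiberScale` is meaningless; b' avoids A.
  · obtain ⟨b', ⟨hb'1, hb'A⟩, hb'2⟩ : ∃ b', (t₀ < b' ∧ (s₀, b') ∉ A) ∧ b' < b := by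
      have hev : ∀ᶠ r in 𝓝 t₀, (s₀, r) ∉ A :=
        (by fun_prop : Continuous fun r : ℝ => (s₀, r)).continuousAt.eventually
          (hA.isOpen_compl.mem_nhds h2)
      have : ∀ᶠ r in 𝓝[>] t₀, (t₀ < r ∧ (s₀, r) ∉ A) ∧ r < b := by
        filter_upwards [self_mem_nhdsWithin, nhdsWithin_le_nhds hev,
          nhdsWithin_le_nhds (Iio_mem_nhds hb)] with r hr1 hr2 hr3
        exact ⟨⟨hr1, hr2⟩, hr3⟩
      exact this.exists
    have hlt : u₀ < fiberScale A (s₀, b') := by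
      have := fiberScale_add_le hA hshift hb'1.le hb'A
      linarith
    have h4 : ∀ᶠ z : Y × ℝ in 𝓝 (s₀, u₀), z.2 < fiberScale A (z.1, b') :=
      continuousAt_snd.eventually_lt (hcts b' hb'A) hlt
    filter_upwards [self_mem_nhdsWithin, nhdsWithin_le_nhds h4] with z hz hz4
    obtain ⟨-, h5, h6⟩ := fiberUnscale_spec hA hshift (hS z.1 hz.1) hz.2
    refine lt_of_not_ge fun hle => ?_
    have := fiberScale_add_le hA hshift (hb'2.le.trans hle) h5
    have h7 : fiberScale A (z.1, fiberUnscale A (z.1, z.2)) = z.2 := h6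
    change b ≤ fiberUnscale A (z.1, z.2) at hle
    linarith

end FiberRescaling

/-! ### The basin of a trapping neighbourhood -/

section Basin

/-- `φ` is a continuous partial flow with open domain `Ω`. -/
structure IsPartialFlow {X : Type*} [TopologicalSpace X] (Ω : Set (ℝ × X)) (φ : ℝ × X → X) :
    Prop where
  isOpen : IsOpen Ω
  continuousAt : ∀ p ∈ Ω, ContinuousAt φ p
  zero : ∀ x, ((0 : ℝ), x) ∈ Ω ∧ φ (0, x) = x
  uIcc : ∀ {s t : ℝ} {x : X}, (t, x) ∈ Ω → s ∈ uIcc 0 t → (s, x) ∈ Ω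
  add : ∀ {s t : ℝ} {x : X}, (s, x) ∈ Ω → (t, φ (s, x)) ∈ Ω →
    (s + t, x) ∈ Ω ∧ φ (s + t, x) = φ (t, φ (s, x))
  neg : ∀ {t : ℝ} {x : X}, (t, x) ∈ Ω → (-t, φ (t, x)) ∈ Ω ∧ φ (-t, φ (t, x)) = x

/-- `N` is a closed set, inside `{‖e‖ ≤ c}`, such that each point of `N` is immediately moved into
its open part `{‖e‖ < c}`. -/
structure IsTrapping {X F : Type*} [TopologicalSpace X] [NormedAddCommGroup F] (Ω : Set (ℝ × X))
    (φ : ℝ × X → X) (e : X → F) (c : ℝ) (N : Set X) : Prop where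
  isClosed : IsClosed N
  continuous : Continuous e
  pos : 0 < c
  norm_le : ∀ x ∈ N, ‖e x‖ ≤ c
  isOpen : IsOpen (N ∩ {x | ‖e x‖ < c})
  enter : ∀ x ∈ N, ∀ t, 0 < t → (t, x) ∈ Ω ∧ φ (t, x) ∈ N ∧ ‖e (φ (t, x))‖ < c

/-- The points which are moved into `N`. -/
def basin {X : Type*} (Ω : Set (ℝ × X)) (φ : ℝ × X → X) (N : Set X) : Set X :=
  {x | ∃ t, 0 ≤ t ∧ (t, x) ∈ Ω ∧ φ (t, x) ∈ N}

/-- The first time at which the trajectory of `x` meets `N`. -/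
def hitTime {X : Type*} (Ω : Set (ℝ × X)) (φ : ℝ × X → X) (N : Set X) (x : X) : ℝ :=
  sInf {t | 0 ≤ t ∧ (t, x) ∈ Ω ∧ φ (t, x) ∈ N}

theorem hitTime_le {X : Type*} {Ω : Set (ℝ × X)} {φ : ℝ × X → X} {N : Set X} {x : X} {t : ℝ}
    (ht : 0 ≤ t) (hΩ : (t, x) ∈ Ω) (hN : φ (t, x) ∈ N) : hitTime Ω φ N x ≤ t :=
  csInf_le ⟨0, fun _ h => h.1⟩ ⟨ht, hΩ, hN⟩

section Topological

variable {X F : Type*} [TopologicalSpace X] [NormedAddCommGroup F] {Ω : Set (ℝ × X)}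
  {φ : ℝ × X → X} {e : X → F} {c : ℝ} {N : Set X}

theorem IsTrapping.enter_of_lt (hN : IsTrapping Ω φ e c N) (hφ : IsPartialFlow Ω φ) {t t' : ℝ}
    {x : X} (hΩ : (t, x) ∈ Ω) (h : φ (t, x) ∈ N) (htt' : t < t') :
    (t', x) ∈ Ω ∧ φ (t', x) ∈ N ∧ ‖e (φ (t', x))‖ < c := by
  obtain ⟨h1, h2, h3⟩ := hN.enter _ h (t' - t) (sub_pos.mpr htt')
  obtain ⟨h4, h5⟩ := hφ.add hΩ h1
  rw [add_sub_cancel] at h4 h5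
  rw [h5]
  exact ⟨h4, h2, h3⟩

/-- The infimum is attained because N is closed. -/
theorem hitTime_spec (hN : IsTrapping Ω φ e c N) (hφ : IsPartialFlow Ω φ) {x : X}
    (hx : x ∈ basin Ω φ N) : 0 ≤ hitTime Ω φ N x ∧ (hitTime Ω φ N x, x) ∈ Ω ∧
      φ (hitTime Ω φ N x, x) ∈ N := by
  obtain ⟨t₀, ht₀, hΩ₀, hN₀⟩ := hx
  have hne : {t | 0 ≤ t ∧ (t, x) ∈ Ω ∧ φ (t, x) ∈ N}.Nonempty := ⟨t₀, ht₀, hΩ₀, hN₀⟩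
  have h0 : 0 ≤ hitTime Ω φ N x := le_csInf hne fun t ht => ht.1
  have hΩ : (hitTime Ω φ N x, x) ∈ Ω :=
    hφ.uIcc hΩ₀ (by rw [uIcc_of_le ht₀]; exact ⟨h0, hitTime_le ht₀ hΩ₀ hN₀⟩)
  refine ⟨h0, hΩ, ?_⟩
  by_contra hnot
  have hcont : ContinuousAt (fun t => φ (t, x)) (hitTime Ω φ N x) :=
    ContinuousAt.comp (g := φ) (f := fun t : ℝ => (t, x)) (hφ.continuousAt _ hΩ) (by fun_prop)
  have hev : ∀ᶠ t in 𝓝 (hitTime Ω φ N x), φ (t, x) ∉ N :=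
    hcont.eventually (hN.isClosed.isOpen_compl.mem_nhds hnot)
  obtain ⟨ε, hε, hball⟩ := Metric.eventually_nhds_iff.mp hev
  obtain ⟨t, ht, hlt⟩ := exists_lt_of_csInf_lt hne
    (show hitTime Ω φ N x < hitTime Ω φ N x + ε by linarith)
  refine hball ?_ ht.2.2
  rw [Real.dist_eq, abs_of_nonneg (sub_nonneg.mpr (hitTime_le ht.1 ht.2.1 ht.2.2))]
  linarith

/-- A first hit in the relatively open part {‖e‖ < c} would have been preceded by an earlier one. -/
theorem norm_apply_hitTime (hN : IsTrapping Ω φ e c N) (hφ : IsPartialFlow Ω φ) {x : X}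
    (hx : x ∈ basin Ω φ N) (hpos : 0 < hitTime Ω φ N x) :
    ‖e (φ (hitTime Ω φ N x, x))‖ = c := by
  obtain ⟨h0, hΩ, hmem⟩ := hitTime_spec hN hφ hx
  refine le_antisymm (hN.norm_le _ hmem) (le_of_not_gt fun hlt => ?_)
  have hcont : ContinuousAt (fun t => φ (t, x)) (hitTime Ω φ N x) :=
    ContinuousAt.comp (g := φ) (f := fun t : ℝ => (t, x)) (hφ.continuousAt _ hΩ) (by fun_prop)
  have hev : ∀ᶠ t in 𝓝 (hitTime Ω φ N x), φ (t, x) ∈ N ∩ {x | ‖e x‖ < c} :=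
    hcont (hN.isOpen.mem_nhds ⟨hmem, hlt⟩)
  have hev2 : ∀ᶠ t in 𝓝[<] hitTime Ω φ N x, (φ (t, x) ∈ N ∧ 0 < t) ∧ t < hitTime Ω φ N x := by
    filter_upwards [nhdsWithin_le_nhds hev, nhdsWithin_le_nhds (Ioi_mem_nhds hpos),
      self_mem_nhdsWithin] with t h1 h2 h3
    exact ⟨⟨h1.1, h2⟩, h3⟩
  obtain ⟨t, ⟨ht1, ht2⟩, ht3⟩ := hev2.exists
  have := hitTime_le ht2.le (hφ.uIcc hΩ (by rw [uIcc_of_le h0]; exact ⟨ht2.le, ht3.le⟩)) ht1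
  linarith

/-- A hit before time t would put s strictly inside {‖e‖ < c}, contradicting ‖e s‖ = c. -/
theorem hitTime_eq (hN : IsTrapping Ω φ e c N) (hφ : IsPartialFlow Ω φ) {s : X} {t : ℝ}
    (hs : s ∈ N) (ht : 0 ≤ t) (hΩ : (-t, s) ∈ Ω) (hor : t = 0 ∨ ‖e s‖ = c) :
    φ (-t, s) ∈ basin Ω φ N ∧ hitTime Ω φ N (φ (-t, s)) = t ∧ φ (t, φ (-t, s)) = s := by
  obtain ⟨h1, h2⟩ := hφ.neg hΩ
  rw [neg_neg] at h1 h2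
  have hb : φ (-t, s) ∈ basin Ω φ N := ⟨t, ht, h1, by rwa [h2]⟩
  refine ⟨hb, le_antisymm (hitTime_le ht h1 (by rwa [h2])) ?_, h2⟩
  obtain ⟨h3, h4, h5⟩ := hitTime_spec hN hφ hb
  rcases hor with rfl | hor
  · exact h3
  · refine le_of_not_gt fun hlt => ?_
    have := (hN.enter_of_lt hφ h4 h5 hlt).2.2
    rw [h2, hor] at this
    exact lt_irrefl _ this

/-- Before the hit the trajectory is outside the closed set N; just after it, inside the open part
of N. Both persist for nearby points, and forward invariance turns them into bounds on the hitting
time. -/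
theorem continuousOn_hitTime (hN : IsTrapping Ω φ e c N) (hφ : IsPartialFlow Ω φ) :
    ContinuousOn (hitTime Ω φ N) (basin Ω φ N) := by
  intro x₀ hx₀
  obtain ⟨h0, hΩ, hmem⟩ := hitTime_spec hN hφ hx₀
  have hcts : ∀ b, (b, x₀) ∈ Ω → ContinuousAt (fun x => φ (b, x)) x₀ := fun b hb =>
    ContinuousAt.comp (g := φ) (f := fun x : X => (b, x)) (hφ.continuousAt _ hb) (by fun_prop)
  have hev : ∀ b, (b, x₀) ∈ Ω → ∀ᶠ x in 𝓝 x₀, (b, x) ∈ Ω := fun b hb =>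
    (by fun_prop : Continuous fun x : X => (b, x)).continuousAt (hφ.isOpen.mem_nhds hb)
  refine tendsto_order.mpr ⟨fun a ha => ?_, fun b hb => ?_⟩
  · rcases lt_or_ge a 0 with ha0 | ha0
    · filter_upwards [self_mem_nhdsWithin] with x hx
      exact ha0.trans_le (hitTime_spec hN hφ hx).1
    · obtain ⟨a', ha', ha't⟩ := exists_between ha
      have ha'0 : 0 ≤ a' := ha0.trans ha'.le
      have haΩ : (a', x₀) ∈ Ω := hφ.uIcc hΩ (by rw [uIcc_of_le h0]; exact ⟨ha'0, ha't.le⟩)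
      have hnot : φ (a', x₀) ∉ N := fun h => (hitTime_le ha'0 haΩ h).not_gt ha't
      have h1 : ∀ᶠ x in 𝓝 x₀, φ (a', x) ∉ N :=
        hcts a' haΩ (hN.isClosed.isOpen_compl.mem_nhds hnot)
      filter_upwards [self_mem_nhdsWithin, nhdsWithin_le_nhds h1] with x hx hx1
      refine ha'.trans_le (le_of_not_gt fun hlt => hx1 ?_)
      obtain ⟨-, h3, h4⟩ := hitTime_spec hN hφ hx
      exact (hN.enter_of_lt hφ h3 h4 hlt).2.1
  · obtain ⟨b', hb'1, hb'2⟩ := exists_between hb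
    obtain ⟨h1, h2⟩ := hN.enter_of_lt hφ hΩ hmem hb'1
    have h3 : ∀ᶠ x in 𝓝 x₀, φ (b', x) ∈ N ∩ {x | ‖e x‖ < c} :=
      hcts b' h1 (hN.isOpen.mem_nhds h2)
    filter_upwards [nhdsWithin_le_nhds h3, nhdsWithin_le_nhds (hev b' h1)] with x hx1 hx2
    exact (hitTime_le (h0.trans hb'1.le) hx2 hx1.1).trans_lt hb'2

theorem continuousOn_apply_hitTime (hN : IsTrapping Ω φ e c N) (hφ : IsPartialFlow Ω φ) :
    ContinuousOn (fun x => φ (hitTime Ω φ N x, x)) (basin Ω φ N) := by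
  intro x hx
  exact ContinuousAt.comp_continuousWithinAt (g := φ)
    (hφ.continuousAt _ (hitTime_spec hN hφ hx).2.1)
    ((continuousOn_hitTime hN hφ x hx).prodMk continuousWithinAt_id)

/-- The points of `N × [0, ∞)` at which the backward flow is not defined. -/
def exitSet (Ω : Set (ℝ × X)) (N : Set X) : Set (X × ℝ) :=
  {z | z.1 ∈ N ∧ 0 ≤ z.2 ∧ (-z.2, z.1) ∉ Ω}

theorem isClosed_exitSet (hN : IsTrapping Ω φ e c N) (hφ : IsPartialFlow Ω φ) :
    IsClosed (exitSet Ω N) :=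
  (hN.isClosed.preimage continuous_fst).inter
    ((isClosed_le continuous_const continuous_snd).inter
      (hφ.isOpen.isClosed_compl.preimage
        (by fun_prop : Continuous fun z : X × ℝ => (-z.2, z.1))))

theorem exitSet_add (hφ : IsPartialFlow Ω φ) (s : X) (t r : ℝ) (hr : 0 ≤ r)
    (h : (s, t) ∈ exitSet Ω N) : (s, t + r) ∈ exitSet Ω N := by
  obtain ⟨h1, h2, h3⟩ := h
  simp only at h2 h3
  refine ⟨h1, by simp only; linarith, fun h => h3 (hφ.uIcc h ?_)⟩
  rw [uIcc_of_ge (by linarith)]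
  exact ⟨by simp only; linarith, by linarith⟩

theorem zero_notMem_exitSet (hφ : IsPartialFlow Ω φ) (s : X) : (s, (0 : ℝ)) ∉ exitSet Ω N :=
  fun h => h.2.2 (by rw [neg_zero]; exact (hφ.zero s).1)

end Topological

section Clip

variable {F : Type*} [NormedAddCommGroup F] [NormedSpace ℝ F]

/-- The radial retraction to the closed ball of radius `c`. -/
def clip (c : ℝ) (y : F) : F := (c / max c ‖y‖) • y

theorem continuous_clip {c : ℝ} (hc : 0 < c) : Continuous (clip c : F → F) :=
  (continuous_const.div (continuous_const.max continuous_norm)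
    fun _ => (lt_max_of_lt_left hc).ne').smul continuous_id

theorem norm_clip {c : ℝ} (hc : 0 < c) (y : F) : ‖clip c y‖ = c * ‖y‖ / max c ‖y‖ := by
  have : 0 < max c ‖y‖ := lt_max_of_lt_left hc
  rw [clip, norm_smul, Real.norm_of_nonneg (by positivity), div_mul_eq_mul_div]

theorem norm_clip_le {c : ℝ} (hc : 0 < c) (y : F) : ‖clip c y‖ ≤ c := by
  have : 0 < max c ‖y‖ := lt_max_of_lt_left hc
  rw [norm_clip hc, div_le_iff₀ this]
  exact mul_le_mul_of_nonneg_left (le_max_right _ _) hc.le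

/-- The relative distance of `y` to the closed ball of radius `c`. -/
def overshoot (c : ℝ) (y : F) : ℝ := max c ‖y‖ / c - 1

omit [NormedSpace ℝ F] in
theorem continuous_overshoot (c : ℝ) : Continuous (overshoot c : F → ℝ) :=
  ((continuous_const.max continuous_norm).div_const c).sub continuous_const

omit [NormedSpace ℝ F] in
theorem overshoot_nonneg {c : ℝ} (hc : 0 < c) (y : F) : 0 ≤ overshoot c y := by
  rw [overshoot, sub_nonneg, one_le_div hc]
  exact le_max_left _ _

/-- With `clip_overshoot_smul` this identifies F with the pairs (z, w) where ‖z‖ ≤ c, w ≥ 0, and w =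
0 or ‖z‖ = c: a ball with half-lines attached to its boundary. -/
theorem overshoot_smul_clip {c : ℝ} (hc : 0 < c) (y : F) :
    (1 + overshoot c y) • clip c y = y := by
  have : 0 < max c ‖y‖ := lt_max_of_lt_left hc
  rw [overshoot, clip, smul_smul, add_sub_cancel, div_mul_div_cancel₀ hc.ne',
    div_self this.ne', one_smul]

theorem overshoot_eq_zero_or {c : ℝ} (hc : 0 < c) (y : F) :
    overshoot c y = 0 ∨ ‖clip c y‖ = c := by
  rcases le_total ‖y‖ c with h | h
  · left
    rw [overshoot, max_eq_left h, div_self hc.ne', sub_self]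
  · right
    rw [norm_clip hc, max_eq_right h, mul_div_assoc, div_self (hc.trans_le h).ne', mul_one]

theorem clip_overshoot_smul {c : ℝ} (hc : 0 < c) {z : F} {w : ℝ} (hw : 0 ≤ w) (hz : ‖z‖ ≤ c)
    (hor : w = 0 ∨ ‖z‖ = c) :
    clip c ((1 + w) • z) = z ∧ overshoot c ((1 + w) • z) = w := by
  have hmax : max c ‖(1 + w) • z‖ = (1 + w) * c := by
    rw [norm_smul, Real.norm_of_nonneg (by linarith)]
    rcases hor with rfl | h
    · rw [add_zero, one_mul, one_mul, max_eq_left hz]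
    · rw [h]
      exact max_eq_right (by nlinarith)
  have h1 : (1 + w) ≠ 0 := by linarith
  constructor
  · rw [clip, hmax, smul_smul]
    have : c / ((1 + w) * c) * (1 + w) = 1 := by field_simp
    rw [this, one_smul]
  · rw [overshoot, hmax, mul_div_cancel_right₀ _ hc.ne']
    ring

end Clip

/-- The basin of a trapping neighbourhood which is a trivial disc bundle over `K` is the trivial
vector bundle over `K`. -/
theorem nonempty_homeomorph_basin {X F : Type*} [EMetricSpace X] [NormedAddCommGroup F]
    [NormedSpace ℝ F] {Ω : Set (ℝ × X)} {φ : ℝ × X → X} {e : X → F} {c : ℝ} {N : Set X}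
    (hN : IsTrapping Ω φ e c N) (hφ : IsPartialFlow Ω φ) {K : Set X} {h : X × F → X} {ρ : X → X}
    (hh : ContinuousOn h (K ×ˢ Metric.closedBall 0 c)) (hρ : ContinuousOn ρ N)
    (hf : ∀ p ∈ K, ∀ v, ‖v‖ ≤ c → h (p, v) ∈ N ∧ e (h (p, v)) = v ∧ ρ (h (p, v)) = p)
    (hb : ∀ q ∈ N, ρ q ∈ K ∧ h (ρ q, e q) = q) :
    Nonempty (basin Ω φ N ≃ₜ F × K) := by
  have hc := hN.pos
  set A := exitSet Ω N with hAdef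
  have hA : IsClosed A := isClosed_exitSet hN hφ
  have hshift : ∀ s t r, 0 ≤ r → (s, t) ∈ A → (s, t + r) ∈ A := exitSet_add hφ
  have h0A : ∀ s, (s, (0 : ℝ)) ∉ A := zero_notMem_exitSet hφ
  have hmemΩ : ∀ s ∈ N, ∀ t, 0 ≤ t → (s, t) ∉ A → (-t, s) ∈ Ω := fun s hs t ht hnot => by
    by_contra hcon
    exact hnot ⟨hs, ht, hcon⟩
  let τ := hitTime Ω φ N
  let σ : X → X := fun x => φ (τ x, x)
  have hτσ : ∀ x ∈ basin Ω φ N, 0 ≤ τ x ∧ σ x ∈ N ∧ (σ x, τ x) ∉ A ∧ φ (-τ x, σ x) = x ∧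
      (τ x = 0 ∨ ‖e (σ x)‖ = c) := by
    intro x hx
    obtain ⟨h1, h2, h3⟩ := hitTime_spec hN hφ hx
    refine ⟨h1, h3, fun hmem => hmem.2.2 (hφ.neg h2).1, (hφ.neg h2).2, ?_⟩
    rcases h1.eq_or_lt with h4 | h4
    · exact Or.inl h4.symm
    · exact Or.inr (norm_apply_hitTime hN hφ hx h4)
  -- The stretched hitting time: x corresponds to (1 + ψ x) • e (σ x) over the base point ρ (σ x).
  let ψ : X → ℝ := fun x => fiberScale A (σ x, τ x)
  have hψ : ∀ x ∈ basin Ω φ N, 0 ≤ ψ x ∧ fiberUnscale A (σ x, ψ x) = τ x ∧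
      (ψ x = 0 ∨ ‖e (σ x)‖ = c) := by
    intro x hx
    obtain ⟨h1, h2, h3, -, h5⟩ := hτσ x hx
    obtain ⟨h6, h7⟩ := fiberUnscale_fiberScale hA hshift (h0A (σ x)) h1 h3
    refine ⟨h6, h7, h5.imp_left fun h8 => ?_⟩
    change fiberScale A (σ x, τ x) = 0
    rw [h8, fiberScale_zero]
  -- For the inverse, s is the entry point in N and θ the time to flow backwards from it.
  let s : F × K → X := fun q => h (q.2, clip c q.1)
  let θ : F × K → ℝ := fun q => fiberUnscale A (s q, overshoot c q.1)
  have hs : ∀ q, s q ∈ N ∧ e (s q) = clip c q.1 ∧ ρ (s q) = q.2 := fun q =>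
    hf q.2 q.2.2 (clip c q.1) (norm_clip_le hc _)
  have hθ : ∀ q, 0 ≤ θ q ∧ (s q, θ q) ∉ A ∧ fiberScale A (s q, θ q) = overshoot c q.1 := fun q =>
    fiberUnscale_spec hA hshift (h0A (s q)) (overshoot_nonneg hc _)
  have hθor : ∀ q, θ q = 0 ∨ ‖e (s q)‖ = c := by
    intro q
    rw [(hs q).2.1]
    refine (overshoot_eq_zero_or hc q.1).imp_left fun h1 => ?_
    have := (fiberUnscale_fiberScale hA hshift (h0A (s q)) le_rfl (h0A (s q))).2
    rw [fiberScale_zero] at this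
    change fiberUnscale A (s q, overshoot c q.1) = 0
    rw [h1, this]
  have hsθΩ : ∀ q, (-θ q, s q) ∈ Ω := fun q => hmemΩ _ (hs q).1 _ (hθ q).1 (hθ q).2.1
  have hG : ∀ q, φ (-θ q, s q) ∈ basin Ω φ N ∧ τ (φ (-θ q, s q)) = θ q ∧
      φ (θ q, φ (-θ q, s q)) = s q := fun q =>
    hitTime_eq hN hφ (hs q).1 (hθ q).1 (hsθΩ q) (hθor q)
  have hτc : ContinuousOn τ (basin Ω φ N) := continuousOn_hitTime hN hφ
  have hσc : ContinuousOn σ (basin Ω φ N) := continuousOn_apply_hitTime hN hφ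
  have hψc : ContinuousOn ψ (basin Ω φ N) := fun x hx =>
    ContinuousAt.comp_continuousWithinAt (g := fiberScale A) (f := fun x => (σ x, τ x))
      (continuousAt_fiberScale hA (hτσ x hx).2.2.1 (h0A _)) ((hσc x hx).prodMk (hτc x hx))
  have hsc : Continuous s := by
    refine hh.comp_continuous ((continuous_subtype_val.comp continuous_snd).prodMk
      ((continuous_clip hc).comp continuous_fst)) fun q => ?_
    exact ⟨q.2.2, mem_closedBall_zero_iff.mpr (norm_clip_le hc _)⟩
  have hθc : Continuous θ := by
    refine (continuousOn_fiberUnscale hA hshift (S := N) fun s _ => h0A s).comp_continuous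
      (hsc.prodMk ((continuous_overshoot c).comp continuous_fst)) fun q => ?_
    exact ⟨(hs q).1, overshoot_nonneg hc _⟩
  refine ⟨{ toFun := fun x => ((1 + ψ x) • e (σ x), ⟨ρ (σ x), (hb _ (hτσ x x.2).2.1).1⟩)
            invFun := fun q => ⟨φ (-θ q, s q), (hG q).1⟩
            left_inv := ?_
            right_inv := ?_
            continuous_toFun := ?_
            continuous_invFun := ?_ }⟩
  · rintro ⟨x, hx⟩
    obtain ⟨h1, h2, h3, h4, -⟩ := hτσ x hx
    obtain ⟨h5, h6, h7⟩ := hψ x hx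
    obtain ⟨h8, h9⟩ := clip_overshoot_smul hc h5 (hN.norm_le _ h2) h7
    refine Subtype.ext ?_
    simp only [θ, s]
    rw [h8, h9, (hb _ h2).2, h6, h4]
  · rintro ⟨y, p⟩
    obtain ⟨-, h2, h3⟩ := hG (y, p)
    obtain ⟨-, h5, h6⟩ := hs (y, p)
    have h7 : σ (φ (-θ (y, p), s (y, p))) = s (y, p) := by
      simp only [σ]
      rw [h2, h3]
    have h8 : ψ (φ (-θ (y, p), s (y, p))) = overshoot c y := by
      simp only [ψ]
      rw [h2, h7, (hθ (y, p)).2.2]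
    refine Prod.ext ?_ (Subtype.ext ?_)
    · simp only
      rw [h7, h8, h5, overshoot_smul_clip hc]
    · simp only
      rw [h7, h6]
  · have hψc' := continuousOn_iff_continuous_domRestrict.mp hψc
    have hσc' := continuousOn_iff_continuous_domRestrict.mp hσc
    refine Continuous.prodMk ((continuous_const.add hψc').smul (hN.continuous.comp hσc')) ?_
    exact (hρ.comp_continuous hσc' fun x => (hτσ x x.2).2.1).subtype_mk _
  · refine Continuous.subtype_mk ?_ _
    refine continuous_iff_continuousAt.mpr fun q => ?_
    exact ContinuousAt.comp (g := φ) (f := fun q => (-θ q, s q)) (hφ.continuousAt _ (hsθΩ q))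
      (hθc.neg.prodMk hsc).continuousAt

end Basin

/-! ### Decrease of ‖e‖ along the guiding flow -/

section GuidingFlow

variable {n m : ℕ} {M : Type*}

theorem isPartialFlow_flow {E : Type*} [NormedAddCommGroup E] [NormedSpace ℝ E] [CompleteSpace E]
    {H : Type*} [TopologicalSpace H] {I : ModelWithCorners ℝ E H} [TopologicalSpace M]
    [ChartedSpace H M] [IsManifold I 1 M] [BoundarylessManifold I M] [T2Space M]
    {v : (x : M) → TangentSpace I x}
    (hv : ContMDiff I I.tangent 1 (fun x => (⟨x, v x⟩ : TangentBundle I M))) :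
    IsPartialFlow (flowDomain v) (flow v) where
  isOpen := isOpen_flowDomain hv
  continuousAt := fun _ h => continuousAt_flow hv h
  zero := fun x => ⟨flowDomain_zero hv x, flow_zero hv x⟩
  uIcc := fun h hs => flowDomain_uIcc h hs
  add := fun hs ht => flow_add hv hs ht
  neg := fun h => flow_neg hv h

section Decrease

variable [TopologicalSpace M] [T2Space M] [ChartedSpace (EuclideanSpace ℝ (Fin n)) M]
  [RiemannianBundle (fun x : M => TangentSpace (𝓡 n) x)] [IsManifold (𝓡 n) ∞ M]
  {e : M → EuclideanSpace ℝ (Fin m)} {v perp : ∀ x : M, TangentSpace (𝓡 n) x}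

/-- The squared norm of the gradient of `‖e‖ ^ 2 / 2`. -/
def decayRate (n : ℕ) {M : Type*} [TopologicalSpace M] [ChartedSpace (EuclideanSpace ℝ (Fin n)) M]
    [RiemannianBundle (fun x : M => TangentSpace (𝓡 n) x)] (e : M → EuclideanSpace ℝ (Fin m))
    (x : M) : ℝ :=
  ‖∑ i, e x i • (gradFamily e x i : TangentSpace (𝓡 n) x)‖ ^ 2

omit [T2Space M] [IsManifold (𝓡 n) ∞ M] in
theorem decayRate_pos {x : M} (hdet : (gradGram n e x).det ≠ 0) (hx : e x ≠ 0) :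
    0 < decayRate n e x := by
  refine pow_pos (lt_of_le_of_ne (norm_nonneg _) fun h => ?_) 2
  have h1 : (∑ i, e x i • (gradFamily e x i : TangentSpace (𝓡 n) x)) = 0 := norm_eq_zero.mp h.symm
  exact sum_smul_gradFamily_ne_zero hdet hx h1

-- By duality ⟨e, de(v)⟩ = ⟨Σ e_i grad e_i, v⟩, and the propagation term drops out by orthogonality.
omit [T2Space M] [IsManifold (𝓡 n) ∞ M] in
theorem inner_mfderiv_guiding (he : MDifferentiable (𝓡 n) 𝓘(ℝ, EuclideanSpace ℝ (Fin m)) e)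
    (hv : ∀ x, v x = perp x - ∑ i, e x i • gradFamily e x i)
    (horth : ∀ x i, inner ℝ (perp x) (gradFamily e x i) = 0) (x : M) :
    inner ℝ (e x) ((mfderiv (𝓡 n) 𝓘(ℝ, EuclideanSpace ℝ (Fin m)) e x :
      TangentSpace (𝓡 n) x →L[ℝ] EuclideanSpace ℝ (Fin m)) (v x)) =
      -decayRate n e x := by
  have h1 : inner ℝ (e x) ((mfderiv (𝓡 n) 𝓘(ℝ, EuclideanSpace ℝ (Fin m)) e x :
      TangentSpace (𝓡 n) x →L[ℝ] EuclideanSpace ℝ (Fin m)) (v x)) =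
      inner ℝ (∑ i, e x i • (gradFamily e x i : TangentSpace (𝓡 n) x)) (v x) := by
    rw [sum_inner]
    refine (PiLp.inner_apply (e x) _).trans (Finset.sum_congr rfl fun i _ => ?_)
    rw [real_inner_smul_left, inner_gradFamily (he x)]
    exact mul_comm _ _
  have h2 : inner ℝ (∑ i, e x i • (gradFamily e x i : TangentSpace (𝓡 n) x)) (perp x) = 0 := by
    rw [sum_inner]
    refine Finset.sum_eq_zero fun i _ => ?_
    rw [real_inner_smul_left, real_inner_comm, horth, mul_zero]
  rw [h1, hv x, inner_sub_right, h2, real_inner_self_eq_norm_sq, zero_sub, decayRate]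

theorem hasDerivAt_norm_sq_flow (hvc : ContMDiff (𝓡 n) (𝓡 n).tangent 1
      (fun x => (⟨x, v x⟩ : TangentBundle (𝓡 n) M)))
    (he : MDifferentiable (𝓡 n) 𝓘(ℝ, EuclideanSpace ℝ (Fin m)) e)
    (hv : ∀ x, v x = perp x - ∑ i, e x i • gradFamily e x i)
    (horth : ∀ x i, inner ℝ (perp x) (gradFamily e x i) = 0) {t : ℝ} {x : M}
    (h : (t, x) ∈ flowDomain v) :
    HasDerivAt (fun s => ‖e (flow v (s, x))‖ ^ 2) (2 * -decayRate n e (flow v (t, x))) t := by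
  have : IsManifold (𝓡 n) 1 M := IsManifold.of_le (n := ∞) (by norm_cast)
  have h1 := (hasDerivAt_comp_flow hvc h (he _)).norm_sq
  rwa [inner_mfderiv_guiding he hv horth] at h1

theorem norm_flow_le (hvc : ContMDiff (𝓡 n) (𝓡 n).tangent 1
      (fun x => (⟨x, v x⟩ : TangentBundle (𝓡 n) M)))
    (he : MDifferentiable (𝓡 n) 𝓘(ℝ, EuclideanSpace ℝ (Fin m)) e)
    (hv : ∀ x, v x = perp x - ∑ i, e x i • gradFamily e x i)
    (horth : ∀ x i, inner ℝ (perp x) (gradFamily e x i) = 0) {s t : ℝ} {x : M} (hs : 0 ≤ s)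
    (hst : s ≤ t) (h : (t, x) ∈ flowDomain v) :
    ‖e (flow v (t, x))‖ ≤ ‖e (flow v (s, x))‖ := by
  have hmem : ∀ r ∈ Icc 0 t, (r, x) ∈ flowDomain v := fun r hr =>
    flowDomain_uIcc h (Icc_subset_uIcc hr)
  have hd := fun r hr => hasDerivAt_norm_sq_flow hvc he hv horth (hmem r hr)
  have hanti : AntitoneOn (fun s => ‖e (flow v (s, x))‖ ^ 2) (Icc 0 t) := by
    refine antitoneOn_of_deriv_nonpos (convex_Icc 0 t)
      (fun r hr => (hd r hr).continuousAt.continuousWithinAt)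
      (fun r hr => (hd r (interior_subset hr)).differentiableAt.differentiableWithinAt)
      fun r hr => ?_
    rw [(hd r (interior_subset hr)).deriv]
    have : 0 ≤ decayRate n e (flow v (r, x)) := sq_nonneg _
    linarith
  exact le_of_sq_le_sq (hanti ⟨hs, hst⟩ ⟨hs.trans hst, le_rfl⟩ hst) (norm_nonneg _)

/-- A negative derivative at time 0 gives a strict drop at some time before t, and monotonicity
preserves it up to t. -/
theorem norm_flow_lt (hvc : ContMDiff (𝓡 n) (𝓡 n).tangent 1
      (fun x => (⟨x, v x⟩ : TangentBundle (𝓡 n) M)))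
    (he : MDifferentiable (𝓡 n) 𝓘(ℝ, EuclideanSpace ℝ (Fin m)) e)
    (hv : ∀ x, v x = perp x - ∑ i, e x i • gradFamily e x i)
    (horth : ∀ x i, inner ℝ (perp x) (gradFamily e x i) = 0) {t : ℝ} {x : M} (ht : 0 < t)
    (h : (t, x) ∈ flowDomain v) (hdet : (gradGram n e x).det ≠ 0) (hx : e x ≠ 0) :
    ‖e (flow v (t, x))‖ < ‖e x‖ := by
  have : IsManifold (𝓡 n) 1 M := IsManifold.of_le (n := ∞) (by norm_cast)
  have hd := hasDerivAt_norm_sq_flow hvc he hv horth (flowDomain_zero hvc x)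
  rw [flow_zero hvc x] at hd
  have hneg : 2 * -decayRate n e x < 0 := by
    have := decayRate_pos hdet hx
    linarith
  have hev := ((hasDerivAt_iff_tendsto_slope.mp hd).mono_left
    (nhdsGT_le_nhdsNE (0 : ℝ))).eventually (gt_mem_nhds hneg)
  obtain ⟨s, hs1, hs2⟩ := (hev.and (Ioo_mem_nhdsGT ht)).exists
  rw [slope_def_field, flow_zero hvc x, sub_zero, div_neg_iff] at hs1
  have hs3 : ‖e (flow v (s, x))‖ ^ 2 < ‖e x‖ ^ 2 := by
    rcases hs1 with h1 | h1
    · exact absurd h1.2 hs2.1.not_gt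
    · linarith [h1.1]
  exact (norm_flow_le hvc he hv horth hs2.1.le hs2.2.le h).trans_lt
    (lt_of_pow_lt_pow_left₀ 2 (norm_nonneg _) hs3)

theorem isTrapping_guiding (hvc : ContMDiff (𝓡 n) (𝓡 n).tangent 1
      (fun x => (⟨x, v x⟩ : TangentBundle (𝓡 n) M)))
    (he : ContMDiff (𝓡 n) 𝓘(ℝ, EuclideanSpace ℝ (Fin m)) 2 e)
    (hv : ∀ x, v x = perp x - ∑ i, e x i • gradFamily e x i)
    (horth : ∀ x i, inner ℝ (perp x) (gradFamily e x i) = 0) {A : Set M} {c : ℝ} (hA : IsOpen A)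
    (hc : 0 < c) (hdet : ∀ x ∈ A, (gradGram n e x).det ≠ 0)
    (hN : IsCompact (A ∩ {x | ‖e x‖ ≤ c}))
    (hforward : ∀ x ∈ A, ∀ t, 0 ≤ t → (t, x) ∈ flowDomain v) :
    IsTrapping (flowDomain v) (flow v) e c (A ∩ {x | ‖e x‖ ≤ c}) where
  isClosed := hN.isClosed
  continuous := he.continuous
  pos := hc
  norm_le := fun x hx => hx.2
  isOpen := by
    have h : A ∩ {x | ‖e x‖ ≤ c} ∩ {x | ‖e x‖ < c} = A ∩ {x | ‖e x‖ < c} := by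
      ext x
      exact ⟨fun h => ⟨h.1.1, h.2⟩, fun h => ⟨⟨h.1, show ‖e x‖ ≤ c from le_of_lt h.2⟩, h.2⟩⟩
    rw [h]
    exact hA.inter (isOpen_lt he.continuous.norm continuous_const)
  enter := by
    have : IsManifold (𝓡 n) 1 M := IsManifold.of_le (n := ∞) (by norm_cast)
    have hed : MDifferentiable (𝓡 n) 𝓘(ℝ, EuclideanSpace ℝ (Fin m)) e :=
      he.mdifferentiable (by norm_num)
    intro x hx t ht
    have hΩ := hforward x hx.1 t ht.le
    have hmem : ∀ r ∈ Icc 0 t, (r, x) ∈ flowDomain v := fun r hr =>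
      flowDomain_uIcc hΩ (Icc_subset_uIcc hr)
    have hle : ∀ r ∈ Icc 0 t, ‖e (flow v (r, x))‖ ≤ c := fun r hr => by
      have := norm_flow_le hvc hed hv horth le_rfl hr.1 (hmem r hr)
      rw [flow_zero hvc x] at this
      exact this.trans hx.2
    have hcont : ContinuousOn (fun r => flow v (r, x)) (Icc 0 t) := fun r hr =>
      (ContinuousAt.comp (g := flow v) (f := fun r => (r, x)) (continuousAt_flow hvc (hmem r hr))
        (continuousAt_id.prodMk continuousAt_const)).continuousWithinAt
    -- As ‖e‖ ≤ c persists, leaving A would mean leaving N. The trajectory is connected and covered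
    -- by the open sets A and Nᶜ, which are disjoint along it, so it stays in A.
    have hsub : (fun r => flow v (r, x)) '' Icc 0 t ⊆ A := by
      refine (isPreconnected_iff_subset_of_disjoint.mp (isPreconnected_Icc.image _ hcont) A _ hA
        hN.isClosed.isOpen_compl ?_ ?_).resolve_right fun hcon => ?_
      · rintro y -
        exact (em (y ∈ A)).imp_right fun h1 h2 => h1 h2.1
      · refine eq_empty_of_forall_notMem ?_
        rintro _ ⟨⟨r, hr, rfl⟩, h1, h2⟩
        exact h2 ⟨h1, hle r hr⟩
      · refine hcon ⟨0, ⟨le_rfl, ht.le⟩, rfl⟩ ?_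
        simpa only [flow_zero hvc x] using hx
    refine ⟨hΩ, ⟨hsub ⟨t, ⟨ht.le, le_rfl⟩, rfl⟩, hle t ⟨ht.le, le_rfl⟩⟩, ?_⟩
    by_cases h0 : e x = 0
    · have := norm_flow_le hvc hed hv horth le_rfl ht.le hΩ
      rw [flow_zero hvc x, h0, norm_zero] at this
      exact this.trans_lt hc
    · exact (norm_flow_lt hvc hed hv horth ht hΩ (hdet x hx.1) h0).trans_le hx.2

end Decrease

end GuidingFlow

/-! ### The domain of attraction as a basin -/

section Attraction

variable {n m : ℕ} {M : Type*} [EMetricSpace M] [ChartedSpace (EuclideanSpace ℝ (Fin n)) M]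

theorem mem_flowDomain_of_mem_domainOfAttraction [IsManifold (𝓡 n) 1 M]
    {v : ∀ x : M, TangentSpace (𝓡 n) x} (hv : ContMDiff (𝓡 n) (𝓡 n).tangent 1
      (fun x => (⟨x, v x⟩ : TangentBundle (𝓡 n) M))) {K : Set M} {x : M}
    (hx : x ∈ GuidingField.domainOfAttraction v K) {t : ℝ} (ht : 0 ≤ t) :
    (t, x) ∈ flowDomain v := by
  obtain ⟨γ, ⟨hγ0, hγ⟩, -⟩ := hx
  exact (flow_eq_of_isMIntegralCurveOn_Ici hv hγ0 hγ ht).1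

theorem mem_domainOfAttraction_iff [IsManifold (𝓡 n) 1 M]
    {v : ∀ x : M, TangentSpace (𝓡 n) x} (hv : ContMDiff (𝓡 n) (𝓡 n).tangent 1
      (fun x => (⟨x, v x⟩ : TangentBundle (𝓡 n) M))) {K : Set M} {x : M} :
    x ∈ GuidingField.domainOfAttraction v K ↔ (∀ t, 0 ≤ t → (t, x) ∈ flowDomain v) ∧
      Tendsto (fun t => Metric.infEDist (flow v (t, x)) K) atTop (𝓝 0) := by
  constructor
  · intro hx
    refine ⟨fun t => mem_flowDomain_of_mem_domainOfAttraction hv hx, ?_⟩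
    obtain ⟨γ, ⟨hγ0, hγ⟩, hlim⟩ := hx
    refine hlim.congr' ?_
    filter_upwards [eventually_ge_atTop 0] with t ht
    rw [(flow_eq_of_isMIntegralCurveOn_Ici hv hγ0 hγ ht).2]
  · rintro ⟨h, hlim⟩
    exact ⟨fun t => flow v (t, x), ⟨flow_zero hv x, fun t ht =>
      (isMIntegralCurveAt_flow hv (h t ht)).hasMFDerivAt.hasMFDerivWithinAt⟩, hlim⟩

/-- A neighbourhood of a compact set contains every set point close to it. -/
theorem IsCompact.exists_infEDist_lt_subset {X : Type*} [EMetricSpace X] {K U : Set X}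
    (hK : IsCompact K) (hU : IsOpen U) (hKU : K ⊆ U) :
    ∃ r : ℝ≥0∞, 0 < r ∧ ∀ x, Metric.infEDist x K < r → x ∈ U := by
  obtain ⟨δ, hδ, h⟩ := hK.exists_thickening_subset_open hU hKU
  exact ⟨ENNReal.ofReal δ, ENNReal.ofReal_pos.mpr hδ, fun x hx => h hx⟩

/-- Convergence to the compact set K forces entry into U; conversely, existence and convergence
after reaching N carry over by a time shift. -/
theorem domainOfAttraction_eq_basin [IsManifold (𝓡 n) 1 M]
    {v : ∀ x : M, TangentSpace (𝓡 n) x} (hv : ContMDiff (𝓡 n) (𝓡 n).tangent 1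
      (fun x => (⟨x, v x⟩ : TangentBundle (𝓡 n) M))) {K U N : Set M} (hK : IsCompact K)
    (hU : IsOpen U) (hKU : K ⊆ U) (hUN : U ⊆ N)
    (hN : N ⊆ GuidingField.domainOfAttraction v K) :
    GuidingField.domainOfAttraction v K = basin (flowDomain v) (flow v) N := by
  ext x
  constructor
  · intro hx
    obtain ⟨h, hlim⟩ := (mem_domainOfAttraction_iff hv).mp hx
    obtain ⟨r, hr, hrU⟩ := hK.exists_infEDist_lt_subset hU hKU
    obtain ⟨t, ht, ht0⟩ := ((hlim.eventually (gt_mem_nhds hr)).and (eventually_ge_atTop 0)).exists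
    exact ⟨t, ht0, h t ht0, hUN (hrU _ ht)⟩
  · rintro ⟨t, ht, hΩ, hx⟩
    obtain ⟨h, hlim⟩ := (mem_domainOfAttraction_iff hv).mp (hN hx)
    refine (mem_domainOfAttraction_iff hv).mpr ⟨fun s hs => ?_, ?_⟩
    · rcases le_total s t with h1 | h1
      · exact flowDomain_uIcc hΩ (Icc_subset_uIcc ⟨hs, h1⟩)
      · have := (flow_add hv hΩ (h (s - t) (sub_nonneg.mpr h1))).1
        rwa [add_sub_cancel] at this
    · have hshift := hlim.comp (tendsto_atTop_add_const_right atTop (-t) tendsto_id)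
      refine hshift.congr' ?_
      filter_upwards [eventually_ge_atTop t] with s hs
      have := (flow_add hv hΩ (h (s + -t) (by linarith))).2
      rw [add_neg_cancel_comm_assoc] at this
      simp only [Function.comp_apply, id_eq]
      rw [← this]

variable [IsManifold (𝓡 n) ∞ M] [RiemannianBundle (fun x : M => TangentSpace (𝓡 n) x)]
  [IsContMDiffRiemannianBundle (𝓡 n) ∞ (EuclideanSpace ℝ (Fin n))
    (fun x : M => TangentSpace (𝓡 n) x)]

/-- The case of unit gains. -/
theorem nonempty_homeomorph_domainOfAttraction {e : M → EuclideanSpace ℝ (Fin m)}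
    (he : ContMDiff (𝓡 n) 𝓘(ℝ, EuclideanSpace ℝ (Fin m)) 2 e)
    {v perp : ∀ x : M, TangentSpace (𝓡 n) x}
    (hperp : ContMDiff (𝓡 n) (𝓡 n).tangent 1
      (fun x => (⟨x, perp x⟩ : TangentBundle (𝓡 n) M)))
    (hv : ∀ x, v x = perp x - ∑ i, e x i • gradFamily e x i)
    (horth : ∀ x i, inner ℝ (perp x) (gradFamily e x i) = 0)
    (hK : IsCompact (GuidingField.zeroLevel e)) (hreg : GuidingField.IsRegularZeroLevel n e)
    (hattr : ∃ r : ℝ≥0∞, 0 < r ∧ ∀ x : M, Metric.infEDist x (GuidingField.zeroLevel e) < r →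
      x ∈ GuidingField.domainOfAttraction v (GuidingField.zeroLevel e)) :
    Nonempty (GuidingField.domainOfAttraction v (GuidingField.zeroLevel e) ≃ₜ
      EuclideanSpace ℝ (Fin m) × GuidingField.zeroLevel e) := by
  have : IsManifold (𝓡 n) 1 M := IsManifold.of_le (n := ∞) (by norm_cast)
  have hvc : ContMDiff (𝓡 n) (𝓡 n).tangent 1
      (fun x => (⟨x, v x⟩ : TangentBundle (𝓡 n) M)) := by
    have hsum := ContMDiff.sum_section (s := Finset.univ)
      (t := fun i (x : M) => e x i • gradFamily e x i) fun i _ =>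
        ((contMDiff_component he i).of_le (by norm_num)).smul_section (contMDiff_gradFamily he i)
    simp only [hv]
    exact hperp.sub_section hsum
  set K := GuidingField.zeroLevel e with hKdef
  obtain ⟨r, hr, hrD⟩ := hattr
  -- Keeping the tube in the region of attraction ensures that trajectories from A exist for all t ≥
  -- 0.
  obtain ⟨A, c, h, ρ, hA, hKA, hA₀, hc, hdet, hcomp, hh, hρ, hf, hb⟩ := exists_tube he hK hreg
    (A₀ := {x | Metric.infEDist x K < r}) (isOpen_lt Metric.continuous_infEDist continuous_const)
    (fun x hx => by rw [mem_ofPred_eq, Metric.infEDist_zero_of_mem hx]; exact hr)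
  have hAD : ∀ x ∈ A, x ∈ GuidingField.domainOfAttraction v K := fun x hx => hrD x (hA₀ hx)
  have hN := isTrapping_guiding hvc he hv horth hA hc hdet hcomp fun x hx t ht =>
    mem_flowDomain_of_mem_domainOfAttraction hvc (hAD x hx) ht
  have hbasin := domainOfAttraction_eq_basin hvc (N := A ∩ {x | ‖e x‖ ≤ c})
    (U := A ∩ {x | ‖e x‖ < c}) hK (hA.inter (isOpen_lt he.continuous.norm continuous_const))
    (fun x hx => ⟨hKA hx, by
      have h0 : e x = 0 := hx
      rw [mem_ofPred_eq, h0, norm_zero]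
      exact hc⟩)
    (fun x hx => ⟨hx.1, show ‖e x‖ ≤ c from le_of_lt hx.2⟩) (fun x hx => hAD x hx.1)
  obtain ⟨Ψ⟩ := nonempty_homeomorph_basin hN (isPartialFlow_flow hvc) hh hρ
    (fun p hp w hw => by
      obtain ⟨h1, h2, h3⟩ := hf p hp w hw
      refine ⟨⟨h1, ?_⟩, h2, h3⟩
      rw [mem_ofPred_eq, h2]
      exact hw)
    (fun q hq => hb q hq.1 hq.2)
  exact ⟨(Homeomorph.setCongr hbasin).trans Ψ⟩

end Attraction

/-! ### Absorbing the gains into e -/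

section Rescale

variable {n m : ℕ} {M : Type*}

/-- The error map with `i`-th component `√(κ i) * e i`. -/
def rescale (κ : Fin m → ℝ) (e : M → EuclideanSpace ℝ (Fin m)) (x : M) :
    EuclideanSpace ℝ (Fin m) :=
  WithLp.toLp 2 fun i => √(κ i) * e x i

theorem zeroLevel_rescale {κ : Fin m → ℝ} (hκ : ∀ i, 0 < κ i) (e : M → EuclideanSpace ℝ (Fin m)) :
    GuidingField.zeroLevel (rescale κ e) = GuidingField.zeroLevel e := by
  ext x
  constructor
  · intro h
    refine PiLp.ext fun i => ?_
    have := congrArg (fun z : EuclideanSpace ℝ (Fin m) => z i) h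
    exact (mul_eq_zero.mp this).resolve_left (Real.sqrt_pos.mpr (hκ i)).ne'
  · intro h
    refine PiLp.ext fun i => ?_
    have h' : e x = 0 := h
    simp [rescale, h']

variable [TopologicalSpace M] [ChartedSpace (EuclideanSpace ℝ (Fin n)) M]

theorem contMDiff_rescale (κ : Fin m → ℝ) {e : M → EuclideanSpace ℝ (Fin m)}
    (he : ContMDiff (𝓡 n) 𝓘(ℝ, EuclideanSpace ℝ (Fin m)) 2 e) :
    ContMDiff (𝓡 n) 𝓘(ℝ, EuclideanSpace ℝ (Fin m)) 2 (rescale κ e) := by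
  have h : ContDiff ℝ 2 (rescale κ (id : EuclideanSpace ℝ (Fin m) → _)) :=
    contDiff_euclidean.mpr fun i => contDiff_const.mul (EuclideanSpace.proj (𝕜 := ℝ) i).contDiff
  exact h.contMDiff.comp he

theorem mfderiv_rescale_component (κ : Fin m → ℝ) {e : M → EuclideanSpace ℝ (Fin m)}
    (he : ContMDiff (𝓡 n) 𝓘(ℝ, EuclideanSpace ℝ (Fin m)) 2 e) (x : M) (i : Fin m)
    (w : TangentSpace (𝓡 n) x) :
    (mfderiv (𝓡 n) 𝓘(ℝ, ℝ) (fun y => rescale κ e y i) x : TangentSpace (𝓡 n) x →L[ℝ] ℝ) w =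
      (√(κ i) • (mfderiv (𝓡 n) 𝓘(ℝ, ℝ) (fun y => e y i) x :
        TangentSpace (𝓡 n) x →L[ℝ] ℝ)) w := by
  have hd : MDifferentiableAt (𝓡 n) 𝓘(ℝ, ℝ) (fun y => e y i) x :=
    (contMDiff_component he i).mdifferentiable (by norm_num) x
  have h := const_smul_mfderiv hd (√(κ i))
  exact congrArg (fun L : TangentSpace (𝓡 n) x →L[ℝ] ℝ => L w) h

theorem isRegularZeroLevel_rescale {κ : Fin m → ℝ} (hκ : ∀ i, 0 < κ i)
    {e : M → EuclideanSpace ℝ (Fin m)}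
    (he : ContMDiff (𝓡 n) 𝓘(ℝ, EuclideanSpace ℝ (Fin m)) 2 e)
    (hreg : GuidingField.IsRegularZeroLevel n e) :
    GuidingField.IsRegularZeroLevel n (rescale κ e) := by
  intro x hx y
  rw [zeroLevel_rescale hκ] at hx
  let z : EuclideanSpace ℝ (Fin m) := y
  obtain ⟨w, hw⟩ := hreg x hx (WithLp.toLp 2 fun i => z i / √(κ i))
  refine ⟨w, PiLp.ext fun i => ?_⟩
  have h1 := mfderiv_component ((contMDiff_rescale κ he).mdifferentiable (by norm_num) x) i w
  have h2 := mfderiv_component (he.mdifferentiable (by norm_num) x) i w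
  have h3 := congrArg (fun z : EuclideanSpace ℝ (Fin m) => z i) hw
  refine (h1.symm.trans (mfderiv_rescale_component κ he x i w)).trans ?_
  refine (congrArg (fun r : ℝ => √(κ i) * r) (h2.trans h3)).trans ?_
  exact mul_div_cancel₀ _ (Real.sqrt_pos.mpr (hκ i)).ne'

theorem gradFamily_rescale [RiemannianBundle (fun x : M => TangentSpace (𝓡 n) x)]
    (κ : Fin m → ℝ) {e : M → EuclideanSpace ℝ (Fin m)}
    (he : ContMDiff (𝓡 n) 𝓘(ℝ, EuclideanSpace ℝ (Fin m)) 2 e) (x : M) (i : Fin m) :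
    (gradFamily (rescale κ e) x i : TangentSpace (𝓡 n) x) = √(κ i) • gradFamily e x i := by
  refine ext_inner_right ℝ fun w => ?_
  rw [real_inner_smul_left, gradFamily, gradFamily, GuidingField.inner_grad,
    GuidingField.inner_grad, mfderiv_rescale_component κ he]
  rfl

end Rescale

end

theorem mainTheorem2 {n k : ℕ} (hk : 1 ≤ k) (hkn : k ≤ n)
    {M : Type*} [EMetricSpace M] [SecondCountableTopology M]
    [ChartedSpace (EuclideanSpace ℝ (Fin n)) M] [IsManifold (𝓡 n) ∞ M]
    [RiemannianBundle (fun x : M => TangentSpace (𝓡 n) x)]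
    [IsContMDiffRiemannianBundle (𝓡 n) ∞ (EuclideanSpace ℝ (Fin n))
      (fun x : M => TangentSpace (𝓡 n) x)]
    [IsRiemannianManifold (𝓡 n) M]
    (e : M → EuclideanSpace ℝ (Fin (n - k)))
    (he : ContMDiff (𝓡 n) 𝓘(ℝ, EuclideanSpace ℝ (Fin (n - k))) 2 e)
    (κ : Fin (n - k) → ℝ) (hκ : ∀ i, 0 < κ i)
    (perp : ∀ x : M, TangentSpace (𝓡 n) x)
    (hperp : ContMDiff (𝓡 n) (𝓡 n).tangent 1
      (fun x => (⟨x, perp x⟩ : TangentBundle (𝓡 n) M)))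
    (hperp_orth : ∀ (x : M) (i : Fin (n - k)),
      inner ℝ (perp x) (GuidingField.grad (fun y => e y i) x) = 0)
    (hcompact : IsCompact (GuidingField.zeroLevel e))
    (hregular : GuidingField.IsRegularZeroLevel n e)
    (hstable : GuidingField.IsAsymptoticallyStable
      (GuidingField.guidingField e κ perp) (GuidingField.zeroLevel e)) :
    Nonempty
      (GuidingField.domainOfAttraction (GuidingField.guidingField e κ perp)
          (GuidingField.zeroLevel e) ≃ₜ
        EuclideanSpace ℝ (Fin (n - k)) × GuidingField.zeroLevel e) := by
  -- The factor √(κ i) occurs once in the component and once in its gradient, so unit gains for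
  -- `rescale κ e` reproduce the gains κ for e.
  have hzero := zeroLevel_rescale hκ e
  have hgrad := fun x i => gradFamily_rescale κ he x i
  have key := nonempty_homeomorph_domainOfAttraction (contMDiff_rescale κ he)
    (v := GuidingField.guidingField e κ perp) hperp ?_ ?_ (hzero ▸ hcompact)
    (isRegularZeroLevel_rescale hκ he hregular) (hzero ▸ hstable.2)
  · rwa [hzero] at key
  · intro x
    rw [GuidingField.guidingField]
    refine congrArg (perp x - ·) (Finset.sum_congr rfl fun i _ => ?_)
    rw [hgrad, smul_smul]
    refine congrArg (· • (gradFamily e x i : TangentSpace (𝓡 n) x)) ?_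
    change _ = √(κ i) * e x i * √(κ i)
    rw [mul_right_comm, Real.mul_self_sqrt (hκ i).le]
  · intro x i
    rw [hgrad, inner_smul_right]
    exact mul_eq_zero_of_right _ (hperp_orth x i)
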